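/- Let $A$ and $B$ be rings (associative, with identity), let $U$ be a $(B,A)$-bimodule and let $T=\begin{pmatrix}A&0\\U&B\end{pmatrix}$. All modules are left modules. A $T$-module is identified with a triple $M=\begin{pmatrix}M_1\\M_2\end{pmatrix}_{\varphi^M}$, where $M_1$ is an $A$-module, $M_2$ is a $B$-module and $\varphi^M:U\otimes_AM_1\to M_2$ is $B$-linear; a $T$-morphism $M\to N$ is a pair $(f_1,f_2)$ of an $A$-linear map $f_1:M_1\to N_1$ and a $B$-linear map $f_2:M_2\to N_2$ with $f_2\varphi^M=\varphi^N(1_U\otimes f_1)$. For an $A$-module $C_1$ and a $B$-module $C_2$ let $\mathbf p(C_1,C_2)=\begin{pmatrix}C_1\\(U\otimes_AC_1)\oplus C_2\end{pmatrix}$, with structure map the inclusion of the first summand. For a ring $R$ and an $R$-module $C$: - $\mathrm{Add}_R(C)$ is the class of modules isomorphic to direct summands of direct sums of copies of $C$. A sequence is $\mathrm{Hom}_R(-,\mathrm{Add}_R(C))$-exact if $\mathrm{Hom}_R(-,F)$ leaves it exact for every $F\in\mathrm{Add}_R(C)$. - $C$ is *w-tilting* if $\mathrm{Ext}^i_R(C,C^{(I)})=0$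 for all $i\ge1$ and all sets $I$, and there is a $\mathrm{Hom}_R(-,\mathrm{Add}_R(C))$-exact exact sequence $0\to R\to A^0\to A^1\to\cdots$ with all $A^i\in\mathrm{Add}_R(C)$. - An $R$-module $M$ is *$G_C$-projective* if there is a $\mathrm{Hom}_R(-,\mathrm{Add}_R(C))$-exact exact sequence $\cdots\to P_1\to P_0\to A^0\to A^1\to\cdots$ with all $P_i$ projective, all $A^i\in\mathrm{Add}_R(C)$ and $M\cong\mathrm{Im}(P_0\to A^0)$; $G_CP(R)$ is the class of these modules. For a class $\mathcal F$ of $R$-modules, $\mathcal F^{\perp_1}$ is the class of modules $N$ with $\mathrm{Ext}^1_R(F,N)=0$ for all $F\in\mathcal F$. An *$\mathcal F$-precover* of $M$ is a morphism $f:F\to M$ with $F\in\mathcal F$ such that $\mathrm{Hom}_R(F',f)$ is surjective for every $F'\in\mathcal F$; it is *special* if moreover $f$ is surjective and $\ker f\in\mathcal F^{\perp_1}$. For $C=\mathbf p(C_1,C_2)$, the bimodule $U$ is *$C$-compatible* if - (a) $U\otimes_A\mathbf X_1$ is exact for every exact sequence $\mathbf X_1:\cdots\to P_1^1\to P_1^0\to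 C_1^0\to C_1^1\to\cdots$ of $A$-modules with all $P_1^i$ projective and all $C_1^i\in\mathrm{Add}_A(C_1)$; and - (b) $\mathrm{Hom}_B(\mathbf X_2,U\otimes_AX)$ is exact for every $X\in\mathrm{Add}_A(C_1)$ and every $\mathrm{Hom}_B(-,\mathrm{Add}_B(C_2))$-exact exact sequence $\mathbf X_2:\cdots\to P_2^1\to P_2^0\to C_2^0\to C_2^1\to\cdots$ of $B$-modules with all $P_2^i$ projective and all $C_2^i\in\mathrm{Add}_B(C_2)$. **Proposition.** Let $C=\mathbf p(C_1,C_2)$ be w-tilting, let $U$ be $C$-compatible, and let $M=\begin{pmatrix}M_1\\M_2\end{pmatrix}_{\varphi^M}$ and $G=\begin{pmatrix}G_1\\G_2\end{pmatrix}_{\varphi^G}$ be two $T$-modules with $G$ $G_C$-projective. A $T$-morphism $f=(f_1,f_2):G\to M$ is a special $G_CP(T)$-precover if and only if - (i) $f_1:G_1\to M_1$ is a special $G_{C_1}P(A)$-precover, and - (ii) $f_2:G_2\to M_2$ is surjective and $\ker f_2\in G_{C_2}P(B)^{\perp_1}$. In this case, if $G_2\in G_{C_2}P(B)$, then $f_2:G_2\to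 M_2$ is a special $G_{C_2}P(B)$-precover. -/

import Mathlib

universe u

set_option linter.unusedSectionVars false

open CategoryTheory
open scoped TensorProduct

namespace RelGor

/-! ### Relative Gorenstein notions over an arbitrary ring -/

section OneRing

variable {R : Type u} [Ring R]

/-- `X` is (isomorphic to) a direct summand of a direct sum of copies of `C`:
`X ⊕ Y ≅ C^(I)` for some set `I` and some module `Y`. -/
def InAdd (C X : Type u) [AddCommGroup C] [Module R C] [AddCommGroup X] [Module R X] : Prop :=
  ∃ (I : Type u) (Y : ModuleCat.{u} R), Nonempty ((X × Y) ≃ₗ[R] (I →₀ C))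

variable (R) in
/-- A doubly infinite sequence `⋯ → X (-1) → X 0 → X 1 → ⋯` of `R`-modules. -/
structure LongSeq where
  X : ℤ → ModuleCat.{u} R
  d : ∀ n : ℤ, X n →ₗ[R] X (n + 1)

/-- The sequence is exact. -/
def LongSeq.IsExact (S : LongSeq R) : Prop :=
  ∀ n : ℤ, Function.Exact (S.d n) (S.d (n + 1))

/-- The sequence `⋯ → Hom(X (n+2), F) → Hom(X (n+1), F) → Hom(X n, F) → ⋯` is exact. -/
def LongSeq.IsHomExact (S : LongSeq R) (F : Type u) [AddCommGroup F] [Module R F] : Prop :=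
  ∀ n : ℤ, Function.Exact
    (fun g : S.X (n + 1 + 1) →ₗ[R] F => g ∘ₗ S.d (n + 1))
    (fun g : S.X (n + 1) →ₗ[R] F => g ∘ₗ S.d n)

/-- The sequence is `Hom(-, Add(C))`-exact. -/
def LongSeq.IsHomAddExact (S : LongSeq R) (C : Type u) [AddCommGroup C] [Module R C] : Prop :=
  ∀ F : ModuleCat.{u} R, InAdd (R := R) C F → S.IsHomExact F

/-- The sequence has the shape `⋯ → P₁ → P₀ → A⁰ → A¹ → ⋯` with all `Pᵢ` projective and all
`Aⁱ` in `Add(C)`; here `Aⁱ` sits in degree `i` and `Pᵢ` in degree `-1 - i`. -/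
def LongSeq.IsProjAdd (S : LongSeq R) (C : Type u) [AddCommGroup C] [Module R C] : Prop :=
  (∀ n : ℤ, n < 0 → Module.Projective R (S.X n)) ∧
    ∀ n : ℤ, 0 ≤ n → InAdd (R := R) C (S.X n)

variable (R) in
/-- The class of `G_C`-projective `R`-modules. -/
def GProj (C : Type u) [AddCommGroup C] [Module R C] : ObjectProperty (ModuleCat.{u} R) :=
  fun M => ∃ S : LongSeq R, S.IsExact ∧ S.IsHomAddExact C ∧ S.IsProjAdd C ∧
    Nonempty (M ≃ₗ[R] LinearMap.range (S.d (-1)))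

variable (R) in
/-- `C` is weakly Wakamatsu tilting. The coresolution `0 → R → A⁰ → A¹ → ⋯` is a long sequence
with `R` in degree `-1`, zero below it, and `Aⁱ` in degree `i`. -/
structure IsWTilting (C : Type u) [AddCommGroup C] [Module R C] : Prop where
  ext_eq_zero : ∀ (I : Type u) (i : ℕ), 1 ≤ i →
    Subsingleton (Abelian.Ext (ModuleCat.of R C) (ModuleCat.of R (I →₀ C)) i)
  exists_coresolution : ∃ S : LongSeq R, S.IsExact ∧ S.IsHomAddExact C ∧
    (∀ n : ℤ, n < -1 → Subsingleton (S.X n)) ∧ Nonempty (R ≃ₗ[R] S.X (-1)) ∧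
    ∀ n : ℤ, 0 ≤ n → InAdd (R := R) C (S.X n)

/-- The class `𝓕^{⊥₁}` of all `N` with `Ext¹(F, N) = 0` for every `F` in `𝓕`. -/
def rightPerpOne (𝓕 : ObjectProperty (ModuleCat.{u} R)) : ObjectProperty (ModuleCat.{u} R) :=
  fun N => ∀ F : ModuleCat.{u} R, 𝓕 F → Subsingleton (Abelian.Ext F N 1)

/-- `f : F → M` is an `𝓕`-precover of `M`. -/
def IsPrecover (𝓕 : ObjectProperty (ModuleCat.{u} R)) {F M : Type u}
    [AddCommGroup F] [Module R F] [AddCommGroup M] [Module R M] (f : F →ₗ[R] M) : Prop :=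
  𝓕 (ModuleCat.of R F) ∧
    ∀ F' : ModuleCat.{u} R, 𝓕 F' → ∀ g : F' →ₗ[R] M, ∃ h : F' →ₗ[R] F, f ∘ₗ h = g

/-- `f : F → M` is a special `𝓕`-precover of `M`. -/
def IsSpecialPrecover (𝓕 : ObjectProperty (ModuleCat.{u} R)) {F M : Type u}
    [AddCommGroup F] [Module R F] [AddCommGroup M] [Module R M] (f : F →ₗ[R] M) : Prop :=
  IsPrecover 𝓕 f ∧ Function.Surjective f ∧
    rightPerpOne 𝓕 (ModuleCat.of R (LinearMap.ker f))

end OneRing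

/-! ### The tensor product `U ⊗_A M` of a `(B, A)`-bimodule with a left `A`-module -/

section Tensor

variable (A B U : Type u) [Ring A] [Ring B] [AddCommGroup U] [Module B U] [Module Aᵐᵒᵖ U]
variable (M N : Type u) [AddCommGroup M] [Module A M] [AddCommGroup N] [Module A N]

/-- The relations `u a ⊗ m = u ⊗ a m`. When the two actions on `U` commute, the additive
subgroup generated by them is already stable under `B`. -/
def balanced : Submodule B (U ⊗[ℤ] M) :=
  Submodule.span B
    {x | ∃ (u : U) (a : A) (m : M), x = (MulOpposite.op a • u) ⊗ₜ[ℤ] m - u ⊗ₜ[ℤ] (a • m)}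

/-- `U ⊗_A M`, as a left `B`-module. -/
abbrev BTensor : Type u := (U ⊗[ℤ] M) ⧸ balanced A B U M

variable {M}

/-- The pure tensor `u ⊗ m` in `U ⊗_A M`. -/
def tmul (u : U) (m : M) : BTensor A B U M := (balanced A B U M).mkQ (u ⊗ₜ[ℤ] m)

variable {N}

/-- `1_U ⊗ f : U ⊗_A M → U ⊗_A N`. -/
def lTensor (f : M →ₗ[A] N) : BTensor A B U M →ₗ[B] BTensor A B U N :=
  Submodule.mapQ _ _
    (TensorProduct.AlgebraTensorModule.map (LinearMap.id : U →ₗ[B] U) (f.restrictScalars ℤ))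
    (by
      rw [balanced, Submodule.span_le]
      rintro _ ⟨u, a, m, rfl⟩
      apply Submodule.subset_span
      exact ⟨u, a, f m, by simp⟩)

theorem lTensor_tmul (f : M →ₗ[A] N) (u : U) (m : M) :
    lTensor A B U f (tmul A B U u m) = tmul A B U u (f m) := by
  simp [lTensor, tmul]

theorem tmul_add (u : U) (m m' : M) :
    tmul A B U u (m + m') = tmul A B U u m + tmul A B U u m' := by
  simp [tmul, TensorProduct.tmul_add]

theorem add_tmul (u u' : U) (m : M) :
    tmul A B U (u + u') m = tmul A B U u m + tmul A B U u' m := by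
  simp [tmul, TensorProduct.add_tmul]

theorem tmul_zero (u : U) : tmul A B U u (0 : M) = 0 := by simp [tmul]

theorem zero_tmul (m : M) : tmul A B U 0 m = 0 := by simp [tmul]

theorem smul_tmul (b : B) (u : U) (m : M) :
    tmul A B U (b • u) m = b • tmul A B U u m := by
  simp only [tmul, ← map_smul, TensorProduct.smul_tmul']

theorem op_smul_tmul (u : U) (a : A) (m : M) :
    tmul A B U (MulOpposite.op a • u) m = tmul A B U u (a • m) := by
  rw [← sub_eq_zero, tmul, tmul, ← map_sub, Submodule.mkQ_apply, Submodule.Quotient.mk_eq_zero]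
  exact Submodule.subset_span ⟨u, a, m, rfl⟩

end Tensor

/-! ### The triangular matrix ring `T = (A 0; U B)` and its modules -/

/-- The underlying set of the triangular matrix ring. -/
@[ext] structure TriRing (A B U : Type u) where
  a : A
  u : U
  b : B

namespace TriRing

variable {A B U : Type u} [Ring A] [Ring B] [AddCommGroup U] [Module B U] [Module Aᵐᵒᵖ U]

instance : Zero (TriRing A B U) := ⟨⟨0, 0, 0⟩⟩
instance : One (TriRing A B U) := ⟨⟨1, 0, 1⟩⟩
instance : Add (TriRing A B U) := ⟨fun s t => ⟨s.a + t.a, s.u + t.u, s.b + t.b⟩⟩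
instance : Neg (TriRing A B U) := ⟨fun s => ⟨-s.a, -s.u, -s.b⟩⟩
instance : Mul (TriRing A B U) :=
  ⟨fun s t => ⟨s.a * t.a, MulOpposite.op t.a • s.u + s.b • t.u, s.b * t.b⟩⟩

@[simp] theorem zero_a : (0 : TriRing A B U).a = 0 := rfl
@[simp] theorem zero_u : (0 : TriRing A B U).u = 0 := rfl
@[simp] theorem zero_b : (0 : TriRing A B U).b = 0 := rfl
@[simp] theorem one_a : (1 : TriRing A B U).a = 1 := rfl
@[simp] theorem one_u : (1 : TriRing A B U).u = 0 := rfl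
@[simp] theorem one_b : (1 : TriRing A B U).b = 1 := rfl
@[simp] theorem add_a (s t : TriRing A B U) : (s + t).a = s.a + t.a := rfl
@[simp] theorem add_u (s t : TriRing A B U) : (s + t).u = s.u + t.u := rfl
@[simp] theorem add_b (s t : TriRing A B U) : (s + t).b = s.b + t.b := rfl
@[simp] theorem neg_a (s : TriRing A B U) : (-s).a = -s.a := rfl
@[simp] theorem neg_u (s : TriRing A B U) : (-s).u = -s.u := rfl
@[simp] theorem neg_b (s : TriRing A B U) : (-s).b = -s.b := rfl
@[simp] theorem mul_a (s t : TriRing A B U) : (s * t).a = s.a * t.a := rfl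
@[simp] theorem mul_u (s t : TriRing A B U) :
    (s * t).u = MulOpposite.op t.a • s.u + s.b • t.u := rfl
@[simp] theorem mul_b (s t : TriRing A B U) : (s * t).b = s.b * t.b := rfl

instance [SMulCommClass B Aᵐᵒᵖ U] : Ring (TriRing A B U) where
  add_assoc x y z := by ext <;> simp [add_assoc]
  zero_add x := by ext <;> simp
  add_zero x := by ext <;> simp
  add_comm x y := by ext <;> simp [add_comm]
  neg_add_cancel x := by ext <;> simp
  nsmul := nsmulRec
  zsmul := zsmulRec
  mul_assoc x y z := by
    ext
    · simp [mul_assoc]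
    · simp [mul_smul, smul_add, add_assoc, smul_comm]
    · simp [mul_assoc]
  one_mul x := by ext <;> simp
  mul_one x := by ext <;> simp
  zero_mul x := by ext <;> simp
  mul_zero x := by ext <;> simp
  left_distrib x y z := by
    ext
    · simp [mul_add]
    · simp only [mul_u, add_u, add_a, MulOpposite.op_add, add_smul, smul_add]; abel
    · simp [mul_add]
  right_distrib x y z := by
    ext
    · simp [add_mul]
    · simp only [mul_u, add_u, add_b, add_smul, smul_add]; abel
    · simp [add_mul]

end TriRing

section TriMod

variable {A B U : Type u} [Ring A] [Ring B] [AddCommGroup U] [Module B U] [Module Aᵐᵒᵖ U]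
variable {M₁ M₂ : Type u} [AddCommGroup M₁] [Module A M₁] [AddCommGroup M₂] [Module B M₂]
variable {N₁ N₂ : Type u} [AddCommGroup N₁] [Module A N₁] [AddCommGroup N₂] [Module B N₂]

/-- The left `T`-module given by the triple `(M₁, M₂, φ)` with `φ : U ⊗_A M₁ → M₂`: the group
`M₁ × M₂` of columns, on which `T` acts by matrix multiplication,
`(a 0; u b) • (m₁, m₂) = (a m₁, φ (u ⊗ m₁) + b m₂)`. -/
@[ext] structure TriMod (φ : BTensor A B U M₁ →ₗ[B] M₂) where
  fst : M₁
  snd : M₂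

variable {φ : BTensor A B U M₁ →ₗ[B] M₂} {ψ : BTensor A B U N₁ →ₗ[B] N₂}

namespace TriMod

instance : Zero (TriMod φ) := ⟨⟨0, 0⟩⟩
instance : Add (TriMod φ) := ⟨fun m n => ⟨m.fst + n.fst, m.snd + n.snd⟩⟩
instance : Neg (TriMod φ) := ⟨fun m => ⟨-m.fst, -m.snd⟩⟩
instance : SMul (TriRing A B U) (TriMod φ) :=
  ⟨fun t m => ⟨t.a • m.fst, φ (tmul A B U t.u m.fst) + t.b • m.snd⟩⟩

@[simp] theorem zero_fst : (0 : TriMod φ).fst = 0 := rfl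
@[simp] theorem zero_snd : (0 : TriMod φ).snd = 0 := rfl
@[simp] theorem add_fst (m n : TriMod φ) : (m + n).fst = m.fst + n.fst := rfl
@[simp] theorem add_snd (m n : TriMod φ) : (m + n).snd = m.snd + n.snd := rfl
@[simp] theorem neg_fst (m : TriMod φ) : (-m).fst = -m.fst := rfl
@[simp] theorem neg_snd (m : TriMod φ) : (-m).snd = -m.snd := rfl
@[simp] theorem smul_fst (t : TriRing A B U) (m : TriMod φ) : (t • m).fst = t.a • m.fst := rfl
@[simp] theorem smul_snd (t : TriRing A B U) (m : TriMod φ) :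
    (t • m).snd = φ (tmul A B U t.u m.fst) + t.b • m.snd := rfl

instance : AddCommGroup (TriMod φ) where
  add_assoc x y z := by ext <;> simp [add_assoc]
  zero_add x := by ext <;> simp
  add_zero x := by ext <;> simp
  add_comm x y := by ext <;> simp [add_comm]
  neg_add_cancel x := by ext <;> simp
  nsmul := nsmulRec
  zsmul := zsmulRec

instance [SMulCommClass B Aᵐᵒᵖ U] : Module (TriRing A B U) (TriMod φ) where
  one_smul m := by ext <;> simp [zero_tmul]
  mul_smul s t m := by
    ext
    · simp [mul_smul]
    · simp [mul_smul, add_tmul, op_smul_tmul, smul_tmul, add_assoc]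
  smul_zero t := by ext <;> simp [tmul_zero]
  smul_add t m n := by
    ext
    · simp
    · simp only [smul_snd, add_snd, add_fst, tmul_add, map_add, smul_add]; abel
  add_smul s t m := by
    ext
    · simp [add_smul]
    · simp only [smul_snd, add_snd, TriRing.add_u, TriRing.add_b, add_tmul, map_add, add_smul]
      abel
  zero_smul m := by ext <;> simp [zero_tmul]

/-- The morphism of `T`-modules given by a pair `(f₁, f₂)` making the square with
`φ` and `ψ` commute. -/
def map [SMulCommClass B Aᵐᵒᵖ U] (f₁ : M₁ →ₗ[A] N₁) (f₂ : M₂ →ₗ[B] N₂)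
    (hf : f₂ ∘ₗ φ = ψ ∘ₗ lTensor A B U f₁) : TriMod φ →ₗ[TriRing A B U] TriMod ψ where
  toFun m := ⟨f₁ m.fst, f₂ m.snd⟩
  map_add' m n := by ext <;> simp
  map_smul' t m := by
    ext
    · simp
    · have h := LinearMap.congr_fun hf (tmul A B U t.u m.fst)
      simp only [LinearMap.comp_apply, lTensor_tmul] at h
      simp [h]

end TriMod

variable (A B U) in
/-- The `T`-module `p(C₁, C₂)`, i.e. the triple `(C₁, (U ⊗_A C₁) ⊕ C₂)` with structure map the
inclusion of the first summand. -/
abbrev pMod (C₁ C₂ : Type u) [AddCommGroup C₁] [Module A C₁] [AddCommGroup C₂] [Module B C₂] :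
    Type u :=
  TriMod (LinearMap.inl B (BTensor A B U C₁) C₂)

variable (A B U) in
/-- The bimodule `U` is `C`-compatible, for `C = p(C₁, C₂)`. -/
structure IsCompatible (C₁ C₂ : Type u) [AddCommGroup C₁] [Module A C₁] [AddCommGroup C₂]
    [Module B C₂] : Prop where
  tensor_exact : ∀ S : LongSeq A, S.IsExact → S.IsProjAdd C₁ →
    ∀ n : ℤ, Function.Exact (lTensor A B U (S.d n)) (lTensor A B U (S.d (n + 1)))
  hom_exact : ∀ S : LongSeq B, S.IsExact → S.IsHomAddExact C₂ → S.IsProjAdd C₂ →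
    ∀ X : ModuleCat.{u} A, InAdd (R := A) C₁ X → S.IsHomExact (BTensor A B U X)

end TriMod

end RelGor

/-! A morphism `F → M` with `F` in a class `𝓕` is a special `𝓕`-precover as soon as it is surjective
with kernel in `𝓕^{⊥₁}`: the lifting property follows from the long exact sequence of `Hom(F', -)`.
So everything reduces to two facts. First, `G₁` inherits `G_{C₁}`-projectivity from `G`. Second, a
`T`-module `N` lies in `G_CP(T)^{⊥₁}` exactly when its components `N₁`, `N₂` lie in the
corresponding classes over `A` and `B` (`rightPerpOne_gProj_iff`). The second fact is applied to the
kernel of `(f₁, f₂)`, whose components are `ker f₁` and `ker f₂`.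

For the Ext comparison, `L ↦ (L, U ⊗ L)` and `Y ↦ (0, Y)` are left adjoint to `N ↦ N₁` and `N ↦ N₂`,
and they preserve projectives. Compatibility makes them carry `G_{C₁}`- and `G_{C₂}`-projectives to
`G_C`-projectives (`gProj_pFree`, `gProj_zMod`). They also transport the relevant projective
presentations, so vanishing of `Ext¹` out of their values is vanishing of `Ext¹` over `A` or `B`
(`ext_one_pFree_iff`, `ext_one_zMod_iff`). This gives one direction.

For the other, a `G_C`-projective `H` has injective structure map, `H₁` is `G_{C₁}`-projective and
the cokernel of the structure map is `G_{C₂}`-projective (`gProj_fst_cok`). The extension `0 → (H₁,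
U ⊗ H₁) → H → (0, Cok H) → 0` then reduces `Ext¹(H, N) = 0` to the two outer terms. The delicate
point is that the first components of a defining sequence of `H` stay `Hom(-, Add(C₁))`-exact
(`LongSeq.IsHomAddExact.fst`); condition (b) of compatibility supplies the correction needed there.
-/

namespace RelGor

section OneRing

variable {R : Type u} [Ring R]

/-! ### Vanishing of `Ext¹` -/

section Ext

open Abelian

/-- The short complex `L → P → X` of an exact pair of linear maps. -/
abbrev exactPair {L P X : Type u} [AddCommGroup L] [Module R L] [AddCommGroup P] [Module R P]
    [AddCommGroup X] [Module R X] (i : L →ₗ[R] P) (p : P →ₗ[R] X) (h : Function.Exact i p) :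
    ShortComplex (ModuleCat.{u} R) :=
  ShortComplex.mk (ModuleCat.ofHom i) (ModuleCat.ofHom p) (by
    ext x; exact h.apply_apply_eq_zero x)

theorem exactPair_shortExact {L P X : Type u} [AddCommGroup L] [Module R L] [AddCommGroup P]
    [Module R P] [AddCommGroup X] [Module R X] {i : L →ₗ[R] P} {p : P →ₗ[R] X}
    (hi : Function.Injective i) (h : Function.Exact i p) (hp : Function.Surjective p) :
    (exactPair i p h).ShortExact where
  exact := (ShortComplex.ShortExact.moduleCat_exact_iff_function_exact _).2 h
  mono_f := (ModuleCat.mono_iff_injective _).2 hi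
  epi_g := (ModuleCat.epi_iff_surjective _).2 hp

/-- The obstruction to extending `g` along `i` is its image under the connecting map `Hom(L, N) →
Ext¹(X, N)`. -/
theorem exists_extension_of_ext_one {L P X N : Type u} [AddCommGroup L] [Module R L]
    [AddCommGroup P] [Module R P] [AddCommGroup X] [Module R X] [AddCommGroup N] [Module R N]
    {i : L →ₗ[R] P} {p : P →ₗ[R] X} (hi : Function.Injective i) (h : Function.Exact i p)
    (hp : Function.Surjective p)
    (hX : Subsingleton (Ext (ModuleCat.of R X) (ModuleCat.of R N) 1)) (g : L →ₗ[R] N) :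
    ∃ k : P →ₗ[R] N, k ∘ₗ i = g := by
  obtain ⟨x, hx⟩ := Ext.contravariant_sequence_exact₁ (exactPair_shortExact hi h hp)
    (ModuleCat.of R N) (Ext.mk₀ (ModuleCat.ofHom g)) (n₁ := 1) rfl (hX.elim _ _)
  obtain ⟨k, rfl⟩ := Ext.addEquiv₀.symm.surjective x
  refine ⟨k.hom, ?_⟩
  have : Ext.mk₀ (ModuleCat.ofHom i ≫ k) = Ext.mk₀ (ModuleCat.ofHom g) := by
    rw [← hx]; exact (Ext.mk₀_comp_mk₀ _ _).symm
  exact congrArg ModuleCat.Hom.hom (Ext.addEquiv₀.symm.injective this)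

/-- As `Ext¹(P, N) = 0`, every class in `Ext¹(X, N)` is the image of some `g : L → N` under the
connecting map, and this image vanishes once `g` extends to `P`. With the previous lemma, `Ext¹`
becomes a pure extension problem, which adjunctions can transport. -/
theorem ext_one_of_exists_extension {L P X N : Type u} [AddCommGroup L] [Module R L]
    [AddCommGroup P] [Module R P] [AddCommGroup X] [Module R X] [AddCommGroup N] [Module R N]
    [Module.Projective R P]
    {i : L →ₗ[R] P} {p : P →ₗ[R] X} (hi : Function.Injective i) (h : Function.Exact i p)
    (hp : Function.Surjective p)
    (hg : ∀ g : L →ₗ[R] N, ∃ k : P →ₗ[R] N, k ∘ₗ i = g) :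
    Subsingleton (Ext (ModuleCat.of R X) (ModuleCat.of R N) 1) := by
  refine subsingleton_of_forall_eq 0 fun x => ?_
  have : Projective (ModuleCat.of R P) := (IsProjective.iff_projective P).1 inferInstance
  obtain ⟨y, rfl⟩ := Ext.contravariant_sequence_exact₃ (exactPair_shortExact hi h hp)
    (ModuleCat.of R N) x (@Ext.eq_zero_of_projective _ _ _ _ (ModuleCat.of R P) _ 0 this _)
    (n₀ := 0) rfl
  obtain ⟨g, rfl⟩ := Ext.addEquiv₀.symm.surjective y
  obtain ⟨k, hk⟩ := hg g.hom
  have : Ext.addEquiv₀.symm g = (Ext.mk₀ (exactPair i p h).f).comp (Ext.mk₀ (ModuleCat.ofHom k))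
      (zero_add 0) := by
    rw [Ext.mk₀_comp_mk₀]
    change Ext.mk₀ g = _
    congr 1
    ext x
    exact (LinearMap.congr_fun hk x).symm
  rw [this]
  exact (exactPair_shortExact hi h hp).extClass_comp_assoc _

theorem ext_one_of_exact {L P X N : Type u} [AddCommGroup L] [Module R L]
    [AddCommGroup P] [Module R P] [AddCommGroup X] [Module R X] [AddCommGroup N] [Module R N]
    {i : L →ₗ[R] P} {p : P →ₗ[R] X} (hi : Function.Injective i) (h : Function.Exact i p)
    (hp : Function.Surjective p)
    (hL : Subsingleton (Ext (ModuleCat.of R L) (ModuleCat.of R N) 1))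
    (hX : Subsingleton (Ext (ModuleCat.of R X) (ModuleCat.of R N) 1)) :
    Subsingleton (Ext (ModuleCat.of R P) (ModuleCat.of R N) 1) := by
  refine subsingleton_of_forall_eq 0 fun x => ?_
  obtain ⟨y, rfl⟩ := Ext.contravariant_sequence_exact₂ (exactPair_shortExact hi h hp)
    (ModuleCat.of R N) x (hL.elim _ _)
  rw [hX.elim y 0, Ext.comp_zero]

theorem ext_one_of_linearEquiv {X N N' : Type u} [AddCommGroup X] [Module R X] [AddCommGroup N]
    [Module R N] [AddCommGroup N'] [Module R N'] (e : N ≃ₗ[R] N')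
    (h : Subsingleton (Ext (ModuleCat.of R X) (ModuleCat.of R N) 1)) :
    Subsingleton (Ext (ModuleCat.of R X) (ModuleCat.of R N') 1) := by
  refine subsingleton_of_forall_eq 0 fun x => ?_
  have h1 : x = (x.comp (Ext.mk₀ e.toModuleIso.inv) (add_zero 1)).comp
      (Ext.mk₀ e.toModuleIso.hom) (add_zero 1) := by
    rw [Ext.comp_assoc_of_third_deg_zero, Ext.mk₀_comp_mk₀, e.toModuleIso.inv_hom_id,
      Ext.comp_mk₀_id]
  rw [h1, h.elim (x.comp _ _) 0, Ext.zero_comp]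

theorem rightPerpOne_of_linearEquiv {𝓕 : ObjectProperty (ModuleCat.{u} R)} {N N' : Type u}
    [AddCommGroup N] [Module R N] [AddCommGroup N'] [Module R N'] (e : N ≃ₗ[R] N')
    (h : rightPerpOne 𝓕 (ModuleCat.of R N)) : rightPerpOne 𝓕 (ModuleCat.of R N') :=
  fun F hF => ext_one_of_linearEquiv e (h F hF)

/-- The obstruction to lifting `F' → M` through the surjection `f` lies in `Ext¹(F', ker f)`, so the
precover condition is automatic. -/
theorem isSpecialPrecover_iff {𝓕 : ObjectProperty (ModuleCat.{u} R)} {F M : Type u}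
    [AddCommGroup F] [Module R F] [AddCommGroup M] [Module R M] {f : F →ₗ[R] M} :
    IsSpecialPrecover 𝓕 f ↔ 𝓕 (ModuleCat.of R F) ∧ Function.Surjective f ∧
      rightPerpOne 𝓕 (ModuleCat.of R (LinearMap.ker f)) := by
  refine ⟨fun h => ⟨h.1.1, h.2⟩, fun h => ⟨⟨h.1, fun F' hF' g => ?_⟩, h.2⟩⟩
  obtain ⟨x, hx⟩ := Ext.covariant_sequence_exact₃ F'
    (exactPair_shortExact (i := (LinearMap.ker f).subtype) (p := f) Subtype.val_injective
      (LinearMap.exact_subtype_ker_map f) h.2.1) (Ext.mk₀ (ModuleCat.ofHom g)) (n₁ := 1) rfl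
    ((h.2.2 F' hF').elim _ _)
  obtain ⟨k, rfl⟩ := Ext.addEquiv₀.symm.surjective x
  refine ⟨k.hom, ?_⟩
  have : Ext.mk₀ (k ≫ ModuleCat.ofHom f) = Ext.mk₀ (ModuleCat.ofHom g) := by
    rw [← hx]; exact (Ext.mk₀_comp_mk₀ _ _).symm
  exact congrArg ModuleCat.Hom.hom (Ext.addEquiv₀.symm.injective this)

end Ext

/-! ### Retracts, `Add(C)` and `G_C`-projective modules -/

/-- `X` is a retract of `Z`. -/
def IsRetract (R : Type u) [Ring R] (X Z : Type u) [AddCommGroup X] [Module R X] [AddCommGroup Z]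
    [Module R Z] : Prop :=
  ∃ (i : X →ₗ[R] Z) (r : Z →ₗ[R] X), r ∘ₗ i = LinearMap.id

theorem IsRetract.trans {X Y Z : Type u} [AddCommGroup X] [Module R X] [AddCommGroup Y]
    [Module R Y] [AddCommGroup Z] [Module R Z] (h : IsRetract R X Y) (h' : IsRetract R Y Z) :
    IsRetract R X Z := by
  obtain ⟨i, r, hr⟩ := h
  obtain ⟨i', r', hr'⟩ := h'
  refine ⟨i' ∘ₗ i, r ∘ₗ r', LinearMap.ext fun x => ?_⟩
  have h1 := LinearMap.congr_fun hr' (i x)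
  have h2 := LinearMap.congr_fun hr x
  simp only [LinearMap.comp_apply, LinearMap.id_apply] at h1 h2 ⊢
  rw [h1, h2]

theorem IsRetract.of_equiv {X Y : Type u} [AddCommGroup X] [Module R X] [AddCommGroup Y]
    [Module R Y] (e : X ≃ₗ[R] Y) : IsRetract R X Y :=
  ⟨e, e.symm, LinearMap.ext fun x => by simp⟩

/-- A split injection has the kernel of its retraction as complement. Retracts are easier to push
through functors than explicit complements. -/
theorem inAdd_iff_isRetract {C X : Type u} [AddCommGroup C] [Module R C] [AddCommGroup X]
    [Module R X] : InAdd (R := R) C X ↔ ∃ I : Type u, IsRetract R X (I →₀ C) := by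
  constructor
  · rintro ⟨I, Y, ⟨e⟩⟩
    exact ⟨I, e.toLinearMap ∘ₗ LinearMap.inl R X Y, LinearMap.fst R X Y ∘ₗ e.symm.toLinearMap,
      LinearMap.ext fun x => by simp⟩
  · rintro ⟨I, i, r, hr⟩
    have hr' : ∀ x, r (i x) = x := fun x => LinearMap.congr_fun hr x
    refine ⟨I, ModuleCat.of R (LinearMap.ker r), ⟨LinearEquiv.ofBijective
      (i.coprod (LinearMap.ker r).subtype) ⟨?_, ?_⟩⟩⟩
    · rw [injective_iff_map_eq_zero]
      rintro ⟨x, y⟩ h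
      simp only [LinearMap.coprod_apply, Submodule.subtype_apply] at h
      have hx : x = 0 := by
        have := congrArg r h
        rwa [map_add, hr', y.2, add_zero, map_zero] at this
      subst hx
      rw [map_zero, zero_add] at h
      exact Prod.ext rfl (Subtype.ext h)
    · intro z
      exact ⟨(r z, ⟨z - i (r z), by simp [hr']⟩), by simp⟩

theorem InAdd.of_isRetract {C X Y : Type u} [AddCommGroup C] [Module R C] [AddCommGroup X]
    [Module R X] [AddCommGroup Y] [Module R Y] (hY : InAdd (R := R) C Y) (h : IsRetract R X Y) :
    InAdd (R := R) C X := by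
  obtain ⟨I, hI⟩ := inAdd_iff_isRetract.1 hY
  exact inAdd_iff_isRetract.2 ⟨I, h.trans hI⟩

theorem inAdd_finsupp (C I : Type u) [AddCommGroup C] [Module R C] :
    InAdd (R := R) C (I →₀ C) :=
  inAdd_iff_isRetract.2 ⟨I, .of_equiv (.refl R _)⟩

theorem LongSeq.IsExact.comp {S : LongSeq R} (hS : S.IsExact) (n : ℤ) (x : S.X n) :
    S.d (n + 1) (S.d n x) = 0 :=
  (hS n).apply_apply_eq_zero x

/-- Composites of consecutive differentials vanish already in `S`, so only the extension half of
exactness has content. -/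
theorem LongSeq.isHomExact_iff {S : LongSeq R} (hS : S.IsExact) (F : Type u) [AddCommGroup F]
    [Module R F] : S.IsHomExact F ↔ ∀ (n : ℤ) (g : S.X (n + 1) →ₗ[R] F), g ∘ₗ S.d n = 0 →
      ∃ k : S.X (n + 1 + 1) →ₗ[R] F, k ∘ₗ S.d (n + 1) = g := by
  constructor
  · intro h n g hg
    exact ((h n) g).1 hg
  · intro h n g
    refine ⟨h n g, ?_⟩
    rintro ⟨k, rfl⟩
    refine LinearMap.ext fun x => ?_
    simp [hS.comp]

theorem LongSeq.IsHomExact.of_isRetract {S : LongSeq R} (hS : S.IsExact) {F F' : Type u}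
    [AddCommGroup F] [Module R F] [AddCommGroup F'] [Module R F'] (h : S.IsHomExact F')
    (hF : IsRetract R F F') : S.IsHomExact F := by
  obtain ⟨i, r, hr⟩ := hF
  rw [isHomExact_iff hS] at h ⊢
  intro n g hg
  obtain ⟨k, hk⟩ := h n (i ∘ₗ g) (by rw [LinearMap.comp_assoc, hg, LinearMap.comp_zero])
  refine ⟨r ∘ₗ k, ?_⟩
  rw [LinearMap.comp_assoc, hk, ← LinearMap.comp_assoc, hr, LinearMap.id_comp]

theorem LongSeq.IsHomExact.prod {S : LongSeq R} (hS : S.IsExact) {F F' : Type u}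
    [AddCommGroup F] [Module R F] [AddCommGroup F'] [Module R F'] (h : S.IsHomExact F)
    (h' : S.IsHomExact F') : S.IsHomExact (F × F') := by
  rw [isHomExact_iff hS] at h h' ⊢
  intro n g hg
  obtain ⟨k, hk⟩ := h n (LinearMap.fst R F F' ∘ₗ g)
    (by rw [LinearMap.comp_assoc, hg, LinearMap.comp_zero])
  obtain ⟨k', hk'⟩ := h' n (LinearMap.snd R F F' ∘ₗ g)
    (by rw [LinearMap.comp_assoc, hg, LinearMap.comp_zero])
  refine ⟨k.prod k', LinearMap.ext fun x => Prod.ext ?_ ?_⟩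
  · exact LinearMap.congr_fun hk x
  · exact LinearMap.congr_fun hk' x

/-- A `G_C`-projective module is the image in degree `-1` of a suitable sequence; the image is
described by a factorization of the differential. -/
theorem gProj_iff {C M : Type u} [AddCommGroup C] [Module R C] [AddCommGroup M] [Module R M] :
    GProj R C (ModuleCat.of R M) ↔ ∃ S : LongSeq R, S.IsExact ∧ S.IsHomAddExact C ∧ S.IsProjAdd C ∧
      ∃ (p : S.X (-1) →ₗ[R] M) (i : M →ₗ[R] S.X (-1 + 1)), Function.Surjective p ∧
        Function.Injective i ∧ i ∘ₗ p = S.d (-1) := by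
  constructor
  · rintro ⟨S, h1, h2, h3, ⟨e⟩⟩
    refine ⟨S, h1, h2, h3, e.symm.toLinearMap ∘ₗ (S.d (-1)).rangeRestrict,
      (LinearMap.range (S.d (-1))).subtype ∘ₗ e.toLinearMap, ?_, ?_, ?_⟩
    · exact e.symm.surjective.comp (S.d (-1)).surjective_rangeRestrict
    · exact Subtype.val_injective.comp e.injective
    · ext x; simp
  · rintro ⟨S, h1, h2, h3, p, i, hp, hi, hip⟩
    refine ⟨S, h1, h2, h3, ⟨(LinearEquiv.ofInjective i hi).trans (LinearEquiv.ofEq _ _ ?_)⟩⟩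
    rw [← hip, LinearMap.range_comp, LinearMap.range_eq_top.2 hp, Submodule.map_top]

theorem GProj.of_equiv {C M N : Type u} [AddCommGroup C] [Module R C] [AddCommGroup M] [Module R M]
    [AddCommGroup N] [Module R N] (e : M ≃ₗ[R] N) (h : GProj R C (ModuleCat.of R M)) :
    GProj R C (ModuleCat.of R N) := by
  obtain ⟨S, h1, h2, h3, ⟨e'⟩⟩ := h
  exact ⟨S, h1, h2, h3, ⟨e.symm.trans e'⟩⟩

end OneRing

end RelGor

namespace RelGor

/-! ### Functoriality and right exactness of `U ⊗_A -` -/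

section Tensor

variable {A B U : Type u} [Ring A] [Ring B] [AddCommGroup U] [Module B U] [Module Aᵐᵒᵖ U]
variable {L M N : Type u} [AddCommGroup L] [Module A L] [AddCommGroup M] [Module A M]
  [AddCommGroup N] [Module A N]
variable {Q : Type u} [AddCommGroup Q] [Module B Q]

theorem bTensor_hom_ext {f g : BTensor A B U M →ₗ[B] Q}
    (h : ∀ u m, f (tmul A B U u m) = g (tmul A B U u m)) : f = g := by
  apply Submodule.linearMap_qext
  exact TensorProduct.AlgebraTensorModule.ext h

/-- The map out of `U ⊗_A M` given by a balanced biadditive map which is `B`-linear in `U`. -/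
def bLift (f : U → M → Q) (add_left : ∀ u u' m, f (u + u') m = f u m + f u' m)
    (add_right : ∀ u m m', f u (m + m') = f u m + f u m')
    (smul_left : ∀ (b : B) u m, f (b • u) m = b • f u m)
    (balance : ∀ u (a : A) m, f (MulOpposite.op a • u) m = f u (a • m)) :
    BTensor A B U M →ₗ[B] Q :=
  Submodule.liftQ _ (TensorProduct.AlgebraTensorModule.lift
    { toFun := fun u => (AddMonoidHom.mk' (f u) (add_right u)).toIntLinearMap
      map_add' := fun u u' => LinearMap.ext (add_left u u')
      map_smul' := fun b u => LinearMap.ext (smul_left b u) })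
    (by
      rw [balanced, Submodule.span_le]
      rintro _ ⟨u, a, m, rfl⟩
      simp [balance])

theorem bLift_tmul (f : U → M → Q) (h₁ h₂ h₃ h₄) (u : U) (m : M) :
    bLift (A := A) (B := B) f h₁ h₂ h₃ h₄ (tmul A B U u m) = f u m := by
  simp [bLift, tmul]

theorem lTensor_comp (g : M →ₗ[A] N) (f : L →ₗ[A] M) :
    lTensor A B U (g ∘ₗ f) = lTensor A B U g ∘ₗ lTensor A B U f :=
  bTensor_hom_ext fun u m => by simp only [LinearMap.comp_apply, lTensor_tmul]

theorem lTensor_id : lTensor A B U (LinearMap.id : M →ₗ[A] M) = LinearMap.id :=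
  bTensor_hom_ext fun u m => by simp only [LinearMap.id_apply, lTensor_tmul]

theorem lTensor_zero : lTensor A B U (0 : M →ₗ[A] N) = 0 :=
  bTensor_hom_ext fun u m => by simp only [LinearMap.zero_apply, lTensor_tmul, tmul_zero]

theorem lTensor_comp_apply (g : M →ₗ[A] N) (f : L →ₗ[A] M) (t : BTensor A B U L) :
    lTensor A B U g (lTensor A B U f t) = lTensor A B U (g ∘ₗ f) t := by
  rw [lTensor_comp, LinearMap.comp_apply]

theorem lTensor_surjective {f : M →ₗ[A] N} (hf : Function.Surjective f) :
    Function.Surjective (lTensor A B U f) := by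
  rw [← LinearMap.range_eq_top, ← Submodule.ker_mkQ (LinearMap.range (lTensor A B U f)),
    LinearMap.ker_eq_top]
  refine bTensor_hom_ext fun u n => ?_
  obtain ⟨m, rfl⟩ := hf n
  rw [← lTensor_tmul]
  exact (Submodule.Quotient.mk_eq_zero _).2 ⟨_, rfl⟩

/-- Right exactness: an explicit map `k` from `U ⊗ N` to the cokernel of `1 ⊗ f` is built from a
set-theoretic section of `g`, and it factors the quotient map through `1 ⊗ g`. -/
theorem lTensor_exact {f : L →ₗ[A] M} {g : M →ₗ[A] N} (h : Function.Exact f g)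
    (hg : Function.Surjective g) :
    Function.Exact (lTensor A B U f) (lTensor A B U g) := by
  -- Two lifts of the same element differ by the image of `f`. This makes the choice of section
  -- harmless, and so `k` additive and balanced.
  have key : ∀ (u : U) {m m' : M}, g m = g m' →
      (LinearMap.range (lTensor A B U f)).mkQ (tmul A B U u m) =
        (LinearMap.range (lTensor A B U f)).mkQ (tmul A B U u m') := by
    intro u m m' hm
    obtain ⟨l, hl⟩ := (h (m - m')).1 (by rw [map_sub, hm, sub_self])
    have : tmul A B U u m = tmul A B U u m' + lTensor A B U f (tmul A B U u l) := by
      rw [lTensor_tmul, hl, ← tmul_add]; simp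
    rw [this, map_add, add_eq_left]
    exact (Submodule.Quotient.mk_eq_zero _).2 ⟨_, rfl⟩
  let s := Function.surjInv hg
  have hs : ∀ n, g (s n) = n := Function.surjInv_eq hg
  let k : BTensor A B U N →ₗ[B] (BTensor A B U M ⧸ LinearMap.range (lTensor A B U f)) :=
    bLift (fun u n => (LinearMap.range (lTensor A B U f)).mkQ (tmul A B U u (s n)))
      (fun u u' m => by rw [add_tmul, map_add])
      (fun u n n' => by
        rw [← map_add, ← tmul_add]; exact key u (by simp [hs]))
      (fun b u n => by rw [smul_tmul, map_smul])
      (fun u a n => by rw [op_smul_tmul]; exact key u (by simp [hs]))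
  have hk : k ∘ₗ lTensor A B U g = (LinearMap.range (lTensor A B U f)).mkQ := by
    refine bTensor_hom_ext fun u m => ?_
    rw [LinearMap.comp_apply, lTensor_tmul, bLift_tmul]
    exact key u (hs _)
  intro t
  constructor
  · intro ht
    have := LinearMap.congr_fun hk t
    rw [LinearMap.comp_apply, ht, map_zero] at this
    exact (Submodule.Quotient.mk_eq_zero _).1 this.symm
  · rintro ⟨t, rfl⟩
    rw [lTensor_comp_apply, show g ∘ₗ f = 0 from LinearMap.ext h.apply_apply_eq_zero, lTensor_zero,
      LinearMap.zero_apply]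

/-- If `U ⊗_A S` is exact, then `U ⊗_A -` preserves the inclusion of a syzygy of `S`. -/
theorem lTensor_injective_of_exact {S : LongSeq A}
    (hS : S.IsExact)
    (hT : ∀ n : ℤ, Function.Exact (lTensor A B U (S.d n)) (lTensor A B U (S.d (n + 1))))
    {m : ℤ} {p : S.X m →ₗ[A] M} {i : M →ₗ[A] S.X (m + 1)} (hp : Function.Surjective p)
    (hi : Function.Injective i) (hip : i ∘ₗ p = S.d m) :
    Function.Injective (lTensor A B U i) := by
  rw [injective_iff_map_eq_zero]
  intro t ht
  obtain ⟨y, rfl⟩ := lTensor_surjective (A := A) (B := B) (U := U) hp t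
  rw [lTensor_comp_apply, hip] at ht
  -- `hT n` expresses exactness in degree `n + 1`; the shift places this at `m`.
  obtain ⟨n, rfl⟩ : ∃ n : ℤ, n + 1 = m := ⟨m - 1, by omega⟩
  obtain ⟨z, rfl⟩ := (hT n y).1 ht
  rw [lTensor_comp_apply]
  have : p ∘ₗ S.d n = 0 := by
    refine LinearMap.ext fun x => hi ?_
    have h1 := LinearMap.congr_fun hip (S.d n x)
    simp only [LinearMap.comp_apply] at h1 ⊢
    rw [h1, hS.comp, LinearMap.zero_apply, map_zero]
  rw [this, lTensor_zero, LinearMap.zero_apply]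

end Tensor

end RelGor

namespace RelGor

/-! ### The triple associated with a module over the triangular matrix ring -/

section Triple

variable {A B U : Type u} [Ring A] [Ring B] [AddCommGroup U] [Module B U] [Module Aᵐᵒᵖ U]
  [SMulCommClass B Aᵐᵒᵖ U]

variable (A B U) in
/-- The component `e₁ N` of a `T`-module `N`. -/
def Fst (N : Type u) [AddCommGroup N] [Module (TriRing A B U) N] : AddSubgroup N where
  carrier := {x | (⟨1, 0, 0⟩ : TriRing A B U) • x = x}
  add_mem' hx hy := (smul_add _ _ _).trans (congrArg₂ _ hx hy)
  zero_mem' := smul_zero _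
  neg_mem' hx := (smul_neg _ _).trans (congrArg _ hx)

variable (A B U) in
/-- The component `e₂ N` of a `T`-module `N`. -/
def Snd (N : Type u) [AddCommGroup N] [Module (TriRing A B U) N] : AddSubgroup N where
  carrier := {x | (⟨0, 0, 1⟩ : TriRing A B U) • x = x}
  add_mem' hx hy := (smul_add _ _ _).trans (congrArg₂ _ hx hy)
  zero_mem' := smul_zero _
  neg_mem' hx := (smul_neg _ _).trans (congrArg _ hx)

variable {N N' N'' : Type u} [AddCommGroup N] [Module (TriRing A B U) N]
  [AddCommGroup N'] [Module (TriRing A B U) N'] [AddCommGroup N''] [Module (TriRing A B U) N'']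

theorem mem_fst {x : N} : x ∈ Fst A B U N ↔ (⟨1, 0, 0⟩ : TriRing A B U) • x = x :=
  Iff.rfl

theorem mem_snd {x : N} : x ∈ Snd A B U N ↔ (⟨0, 0, 1⟩ : TriRing A B U) • x = x :=
  Iff.rfl

theorem smul_mem_fst (a : A) (x : N) : (⟨a, 0, 0⟩ : TriRing A B U) • x ∈ Fst A B U N := by
  rw [mem_fst, smul_smul]; congr 1; ext <;> simp

theorem smul_mem_snd (u : U) (b : B) (x : N) : (⟨0, u, b⟩ : TriRing A B U) • x ∈ Snd A B U N := by
  rw [mem_snd, smul_smul]; congr 1; ext <;> simp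

/-- `A` acts through the corner `e₁ T e₁`. -/
instance : Module A (Fst A B U N) where
  smul a x := ⟨(⟨a, 0, 0⟩ : TriRing A B U) • (x : N), smul_mem_fst a _⟩
  one_smul x := Subtype.ext (mem_fst.1 x.2)
  mul_smul a a' x := Subtype.ext (by
    change (⟨a * a', 0, 0⟩ : TriRing A B U) • (x : N) = (⟨a, 0, 0⟩ : TriRing A B U) •
      (⟨a', 0, 0⟩ : TriRing A B U) • (x : N)
    rw [smul_smul]; congr 1; ext <;> simp)
  smul_zero a := Subtype.ext (smul_zero _)
  smul_add a x y := Subtype.ext (smul_add _ _ _)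
  add_smul a a' x := Subtype.ext (by
    change (⟨a + a', 0, 0⟩ : TriRing A B U) • (x : N) = (⟨a, 0, 0⟩ : TriRing A B U) • (x : N) +
      (⟨a', 0, 0⟩ : TriRing A B U) • (x : N)
    rw [← add_smul]; congr 1; ext <;> simp)
  zero_smul x := Subtype.ext (zero_smul (TriRing A B U) (x : N))

instance : Module B (Snd A B U N) where
  smul b x := ⟨(⟨0, 0, b⟩ : TriRing A B U) • (x : N), smul_mem_snd 0 b _⟩
  one_smul x := Subtype.ext (mem_snd.1 x.2)
  mul_smul a a' x := Subtype.ext (by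
    change (⟨0, 0, a * a'⟩ : TriRing A B U) • (x : N) = (⟨0, 0, a⟩ : TriRing A B U) •
      (⟨0, 0, a'⟩ : TriRing A B U) • (x : N)
    rw [smul_smul]; congr 1; ext <;> simp)
  smul_zero a := Subtype.ext (smul_zero _)
  smul_add a x y := Subtype.ext (smul_add _ _ _)
  add_smul a a' x := Subtype.ext (by
    change (⟨0, 0, a + a'⟩ : TriRing A B U) • (x : N) = (⟨0, 0, a⟩ : TriRing A B U) • (x : N) +
      (⟨0, 0, a'⟩ : TriRing A B U) • (x : N)
    rw [← add_smul]; congr 1; ext <;> simp)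
  zero_smul x := Subtype.ext (zero_smul (TriRing A B U) (x : N))

variable (A B U N) in
/-- The structure map `U ⊗_A e₁ N → e₂ N` of a `T`-module `N`. -/
def phi : BTensor A B U (Fst A B U N) →ₗ[B] Snd A B U N :=
  bLift (fun u x => ⟨(⟨0, u, 0⟩ : TriRing A B U) • (x : N), smul_mem_snd u 0 _⟩)
    (fun u u' x => Subtype.ext (by
      change (⟨0, u + u', 0⟩ : TriRing A B U) • (x : N) = (⟨0, u, 0⟩ : TriRing A B U) • (x : N) +
        (⟨0, u', 0⟩ : TriRing A B U) • (x : N)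
      rw [← add_smul]; congr 1; ext <;> simp))
    (fun u x y => Subtype.ext (smul_add _ _ _))
    (fun b u x => Subtype.ext (by
      change (⟨0, b • u, 0⟩ : TriRing A B U) • (x : N) = (⟨0, 0, b⟩ : TriRing A B U) •
        (⟨0, u, 0⟩ : TriRing A B U) • (x : N)
      rw [smul_smul]; congr 1; ext <;> simp))
    (fun u a x => Subtype.ext (by
      change (⟨0, MulOpposite.op a • u, 0⟩ : TriRing A B U) • (x : N) =
        (⟨0, u, 0⟩ : TriRing A B U) • (⟨a, 0, 0⟩ : TriRing A B U) • (x : N)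
      rw [smul_smul]; congr 1; ext <;> simp))

theorem coe_phi_tmul (u : U) (x : Fst A B U N) :
    (phi A B U N (tmul A B U u x) : N) = (⟨0, u, 0⟩ : TriRing A B U) • (x : N) := by
  rw [phi, bLift_tmul]

/-- The projection of a `T`-module onto its first component. -/
def projFst : N →+ Fst A B U N where
  toFun x := ⟨(⟨1, 0, 0⟩ : TriRing A B U) • x, smul_mem_fst 1 x⟩
  map_zero' := Subtype.ext (smul_zero _)
  map_add' _ _ := Subtype.ext (smul_add _ _ _)

/-- The projection of a `T`-module onto its second component. -/
def projSnd : N →+ Snd A B U N where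
  toFun x := ⟨(⟨0, 0, 1⟩ : TriRing A B U) • x, smul_mem_snd 0 1 x⟩
  map_zero' := Subtype.ext (smul_zero _)
  map_add' _ _ := Subtype.ext (smul_add _ _ _)

variable (A B U) in
theorem projFst_add_projSnd (x : N) :
    (projFst (A := A) (B := B) (U := U) x : N) + (projSnd (A := A) (B := B) (U := U) x : N) =
      x := by
  change (⟨1, 0, 0⟩ : TriRing A B U) • x + (⟨0, 0, 1⟩ : TriRing A B U) • x = x
  rw [← add_smul]
  convert one_smul (TriRing A B U) x
  ext <;> simp

theorem projFst_coe (x : Fst A B U N) : projFst (x : N) = x := Subtype.ext (mem_fst.1 x.2)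

theorem projSnd_coe (x : Snd A B U N) : projSnd (x : N) = x := Subtype.ext (mem_snd.1 x.2)

theorem projFst_coe_snd (x : Snd A B U N) : projFst (A := A) (B := B) (U := U) (x : N) = 0 := by
  rw [← projSnd_coe x]
  refine Subtype.ext ?_
  change (⟨1, 0, 0⟩ : TriRing A B U) • (⟨0, 0, 1⟩ : TriRing A B U) • (x : N) = 0
  rw [smul_smul]
  convert zero_smul (TriRing A B U) (x : N)
  ext <;> simp

theorem projSnd_coe_fst (x : Fst A B U N) : projSnd (A := A) (B := B) (U := U) (x : N) = 0 := by
  rw [← projFst_coe x]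
  refine Subtype.ext ?_
  change (⟨0, 0, 1⟩ : TriRing A B U) • (⟨1, 0, 0⟩ : TriRing A B U) • (x : N) = 0
  rw [smul_smul]
  convert zero_smul (TriRing A B U) (x : N)
  ext <;> simp

theorem projFst_smul (t : TriRing A B U) (x : N) :
    projFst (A := A) (B := B) (U := U) (t • x) = t.a • projFst (A := A) (B := B) (U := U) x := by
  refine Subtype.ext ?_
  change (⟨1, 0, 0⟩ : TriRing A B U) • t • x =
    (⟨t.a, 0, 0⟩ : TriRing A B U) • (⟨1, 0, 0⟩ : TriRing A B U) • x
  rw [smul_smul, smul_smul]; congr 1; ext <;> simp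

/-- With `projFst_smul`, this is matrix multiplication on columns: an abstract `T`-module behaves as
the triple of its two components and `phi`. -/
theorem projSnd_smul (t : TriRing A B U) (x : N) :
    projSnd (A := A) (B := B) (U := U) (t • x) =
      phi A B U N (tmul A B U t.u (projFst x)) + t.b • projSnd (A := A) (B := B) (U := U) x := by
  refine Subtype.ext ?_
  rw [AddSubgroup.coe_add, coe_phi_tmul]
  change (⟨0, 0, 1⟩ : TriRing A B U) • t • x =
    (⟨0, t.u, 0⟩ : TriRing A B U) • (⟨1, 0, 0⟩ : TriRing A B U) • x +
    (⟨0, 0, t.b⟩ : TriRing A B U) • (⟨0, 0, 1⟩ : TriRing A B U) • x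
  rw [smul_smul, smul_smul, smul_smul, ← add_smul]; congr 1; ext <;> simp

/-- The first component of a `T`-linear map. -/
def fstMap (f : N →ₗ[TriRing A B U] N') : Fst A B U N →ₗ[A] Fst A B U N' where
  toFun x := ⟨f x, mem_fst.2 (by rw [← map_smul, mem_fst.1 x.2])⟩
  map_add' x y := Subtype.ext (map_add f _ _)
  map_smul' a x := Subtype.ext (map_smul f _ _)

/-- The second component of a `T`-linear map. -/
def sndMap (f : N →ₗ[TriRing A B U] N') : Snd A B U N →ₗ[B] Snd A B U N' where
  toFun x := ⟨f x, mem_snd.2 (by rw [← map_smul, mem_snd.1 x.2])⟩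
  map_add' x y := Subtype.ext (map_add f _ _)
  map_smul' a x := Subtype.ext (map_smul f _ _)

@[simp] theorem coe_fstMap (f : N →ₗ[TriRing A B U] N') (x : Fst A B U N) :
    (fstMap f x : N') = f x := rfl

@[simp] theorem coe_sndMap (f : N →ₗ[TriRing A B U] N') (x : Snd A B U N) :
    (sndMap f x : N') = f x := rfl

theorem fstMap_comp (g : N' →ₗ[TriRing A B U] N'') (f : N →ₗ[TriRing A B U] N') :
    fstMap (g ∘ₗ f) = fstMap g ∘ₗ fstMap f := rfl

theorem sndMap_comp (g : N' →ₗ[TriRing A B U] N'') (f : N →ₗ[TriRing A B U] N') :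
    sndMap (g ∘ₗ f) = sndMap g ∘ₗ sndMap f := rfl

theorem projFst_map (f : N →ₗ[TriRing A B U] N') (x : N) :
    projFst (A := A) (B := B) (U := U) (f x) = fstMap f (projFst x) :=
  Subtype.ext (map_smul f _ _).symm

theorem projSnd_map (f : N →ₗ[TriRing A B U] N') (x : N) :
    projSnd (A := A) (B := B) (U := U) (f x) = sndMap f (projSnd x) :=
  Subtype.ext (map_smul f _ _).symm

theorem sndMap_comp_phi (f : N →ₗ[TriRing A B U] N') :
    sndMap f ∘ₗ phi A B U N = phi A B U N' ∘ₗ lTensor A B U (fstMap f) :=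
  bTensor_hom_ext fun u x => Subtype.ext (by
    simp only [LinearMap.comp_apply, lTensor_tmul, coe_sndMap, coe_phi_tmul, map_smul, coe_fstMap])

theorem sndMap_phi (f : N →ₗ[TriRing A B U] N') (t : BTensor A B U (Fst A B U N)) :
    sndMap f (phi A B U N t) = phi A B U N' (lTensor A B U (fstMap f) t) :=
  LinearMap.congr_fun (sndMap_comp_phi f) t

theorem triMap_ext {f g : N →ₗ[TriRing A B U] N'} (h₁ : fstMap f = fstMap g)
    (h₂ : sndMap f = sndMap g) : f = g := by
  ext x
  rw [← projFst_add_projSnd A B U x, map_add, map_add]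
  congr 1
  · exact congrArg Subtype.val (LinearMap.congr_fun h₁ _)
  · exact congrArg Subtype.val (LinearMap.congr_fun h₂ _)

theorem fstMap_surjective {f : N →ₗ[TriRing A B U] N'} (hf : Function.Surjective f) :
    Function.Surjective (fstMap f) := fun y => by
  obtain ⟨x, hx⟩ := hf y
  exact ⟨projFst x, by rw [← projFst_map, hx, projFst_coe]⟩

theorem sndMap_surjective {f : N →ₗ[TriRing A B U] N'} (hf : Function.Surjective f) :
    Function.Surjective (sndMap f) := fun y => by
  obtain ⟨x, hx⟩ := hf y
  exact ⟨projSnd x, by rw [← projSnd_map, hx, projSnd_coe]⟩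

theorem fstMap_injective {f : N →ₗ[TriRing A B U] N'} (hf : Function.Injective f) :
    Function.Injective (fstMap f) := fun _ _ h => Subtype.ext (hf (congrArg Subtype.val h))

theorem sndMap_injective {f : N →ₗ[TriRing A B U] N'} (hf : Function.Injective f) :
    Function.Injective (sndMap f) := fun _ _ h => Subtype.ext (hf (congrArg Subtype.val h))

theorem fstMap_exact {f : N →ₗ[TriRing A B U] N'} {g : N' →ₗ[TriRing A B U] N''}
    (h : Function.Exact f g) : Function.Exact (fstMap f) (fstMap g) := by
  intro y
  constructor
  · intro hy
    obtain ⟨x, hx⟩ := (h y).1 (congrArg Subtype.val hy)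
    exact ⟨projFst x, by rw [← projFst_map, hx, projFst_coe]⟩
  · rintro ⟨x, rfl⟩
    exact Subtype.ext (h.apply_apply_eq_zero _)

theorem sndMap_exact {f : N →ₗ[TriRing A B U] N'} {g : N' →ₗ[TriRing A B U] N''}
    (h : Function.Exact f g) : Function.Exact (sndMap f) (sndMap g) := by
  intro y
  constructor
  · intro hy
    obtain ⟨x, hx⟩ := (h y).1 (congrArg Subtype.val hy)
    exact ⟨projSnd x, by rw [← projSnd_map, hx, projSnd_coe]⟩
  · rintro ⟨x, rfl⟩
    exact Subtype.ext (h.apply_apply_eq_zero _)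

namespace TriMod

variable {M₁ M₂ : Type u} [AddCommGroup M₁] [Module A M₁] [AddCommGroup M₂] [Module B M₂]
  {φ : BTensor A B U M₁ →ₗ[B] M₂}

/-- The `T`-linear map out of a triple given by its components. -/
def desc (g₁ : M₁ →ₗ[A] Fst A B U N) (g₂ : M₂ →ₗ[B] Snd A B U N)
    (h : g₂ ∘ₗ φ = phi A B U N ∘ₗ lTensor A B U g₁) : TriMod φ →ₗ[TriRing A B U] N where
  toFun m := (g₁ m.fst : N) + (g₂ m.snd : N)
  map_add' m m' := by
    simp only [add_fst, add_snd, map_add, AddSubgroup.coe_add]; abel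
  map_smul' t m := by
    have h1 := LinearMap.congr_fun h (tmul A B U t.u m.fst)
    simp only [LinearMap.comp_apply, lTensor_tmul] at h1
    rw [smul_fst, smul_snd, map_add, map_smul, map_smul, h1, ← projFst_add_projSnd A B U
      (_ • (_ + _)), projFst_smul, projSnd_smul, map_add, map_add, projFst_coe, projFst_coe_snd,
      projSnd_coe, projSnd_coe_fst, add_zero, zero_add]
    rfl

theorem desc_apply (g₁ : M₁ →ₗ[A] Fst A B U N) (g₂ : M₂ →ₗ[B] Snd A B U N) (h) (m : TriMod φ) :
    desc g₁ g₂ h m = (g₁ m.fst : N) + (g₂ m.snd : N) := rfl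

/-- The `T`-linear map into a triple given by its components. -/
def lift (g₁ : Fst A B U N →ₗ[A] M₁) (g₂ : Snd A B U N →ₗ[B] M₂)
    (h : g₂ ∘ₗ phi A B U N = φ ∘ₗ lTensor A B U g₁) : N →ₗ[TriRing A B U] TriMod φ where
  toFun x := ⟨g₁ (projFst x), g₂ (projSnd x)⟩
  map_add' m m' := by ext <;> simp
  map_smul' t m := by
    have h1 := LinearMap.congr_fun h (tmul A B U t.u (projFst m))
    simp only [LinearMap.comp_apply, lTensor_tmul] at h1
    ext
    · simp [projFst_smul]
    · simp [projSnd_smul, h1]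

theorem lift_apply (g₁ : Fst A B U N →ₗ[A] M₁) (g₂ : Snd A B U N →ₗ[B] M₂) (h) (x : N) :
    (lift g₁ g₂ h : N →ₗ[TriRing A B U] TriMod φ) x = ⟨g₁ (projFst x), g₂ (projSnd x)⟩ := rfl

theorem mem_fst_iff {m : TriMod φ} : m ∈ Fst A B U (TriMod φ) ↔ m.snd = 0 := by
  rw [mem_fst, TriMod.ext_iff]
  simp [zero_tmul, eq_comm]

theorem mem_snd_iff {m : TriMod φ} : m ∈ Snd A B U (TriMod φ) ↔ m.fst = 0 := by
  rw [mem_snd, TriMod.ext_iff]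
  simp [zero_tmul, eq_comm]

variable (φ) in
/-- The first component of the `T`-module given by a triple. -/
def fstEquiv : Fst A B U (TriMod φ) ≃ₗ[A] M₁ where
  toFun x := x.1.fst
  map_add' _ _ := rfl
  map_smul' _ _ := rfl
  invFun m := ⟨⟨m, 0⟩, mem_fst_iff.2 rfl⟩
  left_inv x := Subtype.ext (TriMod.ext rfl (mem_fst_iff.1 x.2).symm)
  right_inv _ := rfl

variable (φ) in
/-- The second component of the `T`-module given by a triple. -/
def sndEquiv : Snd A B U (TriMod φ) ≃ₗ[B] M₂ where
  toFun x := x.1.snd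
  map_add' _ _ := rfl
  map_smul' b x := by
    change φ (tmul A B U 0 x.1.fst) + b • x.1.snd = b • x.1.snd
    rw [zero_tmul, map_zero, zero_add]
  invFun m := ⟨⟨0, m⟩, mem_snd_iff.2 rfl⟩
  left_inv x := Subtype.ext (TriMod.ext (mem_snd_iff.1 x.2).symm rfl)
  right_inv _ := rfl

theorem fstEquiv_apply (x : Fst A B U (TriMod φ)) : fstEquiv φ x = x.1.fst := rfl

theorem sndEquiv_phi (t : BTensor A B U (Fst A B U (TriMod φ))) :
    sndEquiv φ (phi A B U (TriMod φ) t) = φ (lTensor A B U (fstEquiv φ).toLinearMap t) := by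
  suffices h : (sndEquiv φ).toLinearMap ∘ₗ phi A B U (TriMod φ) =
      φ ∘ₗ lTensor A B U (fstEquiv φ).toLinearMap from LinearMap.congr_fun h t
  refine bTensor_hom_ext fun u x => ?_
  rw [LinearMap.comp_apply, LinearMap.comp_apply, lTensor_tmul]
  change ((phi A B U (TriMod φ) (tmul A B U u x)) : TriMod φ).snd = _
  rw [coe_phi_tmul]
  simp [fstEquiv_apply]

end TriMod

end Triple

end RelGor

namespace RelGor

/-! ### Free and concentrated triples, and `Add(p(C₁, C₂))` -/

section TriAdd

variable {A B U : Type u} [Ring A] [Ring B] [AddCommGroup U] [Module B U] [Module Aᵐᵒᵖ U]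
  [SMulCommClass B Aᵐᵒᵖ U]
variable {N N' N'' : Type u} [AddCommGroup N] [Module (TriRing A B U) N]
  [AddCommGroup N'] [Module (TriRing A B U) N'] [AddCommGroup N''] [Module (TriRing A B U) N'']
variable {L L' : Type u} [AddCommGroup L] [Module A L] [AddCommGroup L'] [Module A L']
variable {Y Y' : Type u} [AddCommGroup Y] [Module B Y] [AddCommGroup Y'] [Module B Y']

variable (A B U L) in
/-- The triple `(L, U ⊗_A L)`, isomorphic to `p(L, 0)`. -/
abbrev pFree : Type u := TriMod (LinearMap.id : BTensor A B U L →ₗ[B] BTensor A B U L)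

variable (A B U Y) in
/-- The triple `(0, Y)`, isomorphic to `p(0, Y)`. -/
abbrev zMod : Type u := TriMod (0 : BTensor A B U PUnit.{u + 1} →ₗ[B] Y)

/-- The functor `L ↦ (L, U ⊗_A L)` on morphisms. -/
abbrev pFreeMap (f : L →ₗ[A] L') : pFree A B U L →ₗ[TriRing A B U] pFree A B U L' :=
  TriMod.map f (lTensor A B U f) rfl

/-- The functor `Y ↦ (0, Y)` on morphisms. -/
abbrev zModMap (f : Y →ₗ[B] Y') : zMod A B U Y →ₗ[TriRing A B U] zMod A B U Y' :=
  TriMod.map LinearMap.id f (by simp)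

/-- The map `(L, U ⊗_A L) → N` induced by `L → e₁ N`. -/
def pFreeDesc (g : L →ₗ[A] Fst A B U N) : pFree A B U L →ₗ[TriRing A B U] N :=
  TriMod.desc g (phi A B U N ∘ₗ lTensor A B U g) rfl

theorem pFreeDesc_mk (g : L →ₗ[A] Fst A B U N) (x : L) : pFreeDesc g ⟨x, 0⟩ = g x := by
  simp [pFreeDesc, TriMod.desc_apply]

/-- The map `(0, Y) → N` induced by `Y → e₂ N`. -/
def zModDesc (g : Y →ₗ[B] Snd A B U N) : zMod A B U Y →ₗ[TriRing A B U] N :=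
  TriMod.desc 0 g (by rw [lTensor_zero]; simp)

theorem zModDesc_apply (g : Y →ₗ[B] Snd A B U N) (m : zMod A B U Y) :
    zModDesc g m = g m.snd := by
  simp [zModDesc, TriMod.desc_apply]

/-- The restriction of a map `(L, U ⊗_A L) → N` to `L`. -/
def pFreeRes (f : pFree A B U L →ₗ[TriRing A B U] N) : L →ₗ[A] Fst A B U N :=
  fstMap f ∘ₗ (TriMod.fstEquiv _).symm.toLinearMap

/-- The restriction of a map `(0, Y) → N` to `Y`. -/
def zModRes (f : zMod A B U Y →ₗ[TriRing A B U] N) : Y →ₗ[B] Snd A B U N :=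
  sndMap f ∘ₗ (TriMod.sndEquiv _).symm.toLinearMap

/-- The structure map of `(L, U ⊗ L)` is onto, so the module is generated by its first component. -/
theorem pFree_hom_ext {f g : pFree A B U L →ₗ[TriRing A B U] N}
    (h : ∀ x, f ⟨x, 0⟩ = g ⟨x, 0⟩) : f = g := by
  have h₁ : fstMap f = fstMap g := by
    refine LinearMap.ext fun x => Subtype.ext ?_
    have hx : (x : pFree A B U L) = ⟨x.1.fst, 0⟩ := TriMod.ext rfl (TriMod.mem_fst_iff.1 x.2)
    rw [coe_fstMap, coe_fstMap, hx, h]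
  refine triMap_ext h₁ (LinearMap.ext fun y => ?_)
  obtain ⟨t, rfl⟩ : ∃ t, phi A B U (pFree A B U L) t = y := by
    obtain ⟨t, ht⟩ := lTensor_surjective (A := A) (B := B) (U := U)
      (TriMod.fstEquiv (LinearMap.id : BTensor A B U L →ₗ[B] BTensor A B U L)).surjective
      (TriMod.sndEquiv _ y)
    exact ⟨t, (TriMod.sndEquiv _).injective ((TriMod.sndEquiv_phi t).trans ht)⟩
  rw [sndMap_phi, sndMap_phi, h₁]

theorem zMod_hom_ext {f g : zMod A B U Y →ₗ[TriRing A B U] N}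
    (h : ∀ y, f ⟨0, y⟩ = g ⟨0, y⟩) : f = g :=
  LinearMap.ext fun y => h y.snd

theorem pMod_hom_ext {f g : pMod A B U L Y →ₗ[TriRing A B U] N}
    (h₁ : ∀ x, f ⟨x, 0⟩ = g ⟨x, 0⟩) (h₂ : ∀ y, f ⟨0, (0, y)⟩ = g ⟨0, (0, y)⟩) : f = g := by
  let k : pFree A B U L →ₗ[TriRing A B U] pMod A B U L Y :=
    TriMod.map LinearMap.id (LinearMap.inl B _ _) (by rw [lTensor_id])
  have hk : f ∘ₗ k = g ∘ₗ k := pFree_hom_ext h₁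
  ext m
  have hm : m = k ⟨m.fst, m.snd.1⟩ + ⟨0, (0, m.snd.2)⟩ := by
    ext
    · simp [k, TriMod.map]
    · simp [k, TriMod.map]
    · simp [k, TriMod.map]
  rw [hm, map_add, map_add, h₂]
  congr 1
  exact LinearMap.congr_fun hk _

/-- The map `p(L, Y) → N` induced by `L → e₁ N` and `Y → e₂ N`. -/
def pModDesc (g₁ : L →ₗ[A] Fst A B U N) (g₂ : Y →ₗ[B] Snd A B U N) :
    pMod A B U L Y →ₗ[TriRing A B U] N :=
  TriMod.desc g₁ ((phi A B U N ∘ₗ lTensor A B U g₁).coprod g₂) (by simp)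

theorem pModDesc_mk (g₁ : L →ₗ[A] Fst A B U N) (g₂ : Y →ₗ[B] Snd A B U N) (x : L) (y : Y) :
    pModDesc g₁ g₂ ⟨x, (0, y)⟩ = (g₁ x : N) + (g₂ y : N) := by
  simp [pModDesc, TriMod.desc_apply]

variable (A B U) in
/-- `p` commutes with direct sums of copies of a module. -/
theorem finsupp_pMod_equiv (I C₁ C₂ : Type u) [AddCommGroup C₁] [Module A C₁] [AddCommGroup C₂]
    [Module B C₂] : Nonempty ((I →₀ pMod A B U C₁ C₂) ≃ₗ[TriRing A B U]
      pMod A B U (I →₀ C₁) (I →₀ C₂)) := by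
  let α : (I →₀ pMod A B U C₁ C₂) →ₗ[TriRing A B U] pMod A B U (I →₀ C₁) (I →₀ C₂) :=
    Finsupp.lsum ℕ fun i => TriMod.map (Finsupp.lsingle i)
      (LinearMap.prodMap (lTensor A B U (Finsupp.lsingle i)) (Finsupp.lsingle i))
      (LinearMap.ext fun x => Prod.ext rfl (map_zero (Finsupp.lsingle i : C₂ →ₗ[B] I →₀ C₂)))
  let g₁ : (I →₀ C₁) →ₗ[A] Fst A B U (I →₀ pMod A B U C₁ C₂) :=
    Finsupp.lsum ℕ fun i => fstMap (Finsupp.lsingle i) ∘ₗ (TriMod.fstEquiv _).symm.toLinearMap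
  let g₂ : (I →₀ C₂) →ₗ[B] Snd A B U (I →₀ pMod A B U C₁ C₂) :=
    Finsupp.lsum ℕ fun i => sndMap (Finsupp.lsingle i) ∘ₗ (TriMod.sndEquiv _).symm.toLinearMap ∘ₗ
      LinearMap.inr B _ _
  let β : pMod A B U (I →₀ C₁) (I →₀ C₂) →ₗ[TriRing A B U] (I →₀ pMod A B U C₁ C₂) :=
    pModDesc g₁ g₂
  have hα₁ : ∀ i x, α (Finsupp.single i ⟨x, 0⟩) = ⟨Finsupp.single i x, 0⟩ := fun i x => by
    simp only [α, Finsupp.lsum_single]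
    exact TriMod.ext rfl (map_zero _)
  have hα₂ : ∀ i y, α (Finsupp.single i ⟨0, (0, y)⟩) = ⟨0, (0, Finsupp.single i y)⟩ :=
    fun i y => by
      simp only [α, Finsupp.lsum_single]
      exact TriMod.ext (map_zero _) (Prod.ext (map_zero (lTensor A B U (Finsupp.lsingle i))) rfl)
  have hβ₁ : ∀ x, β ⟨x, 0⟩ = g₁ x := fun x => by
    have := pModDesc_mk g₁ g₂ x 0
    rwa [map_zero, AddSubgroup.coe_zero, add_zero] at this
  have hβ₂ : ∀ y, β ⟨0, (0, y)⟩ = g₂ y := fun y => by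
    have := pModDesc_mk g₁ g₂ 0 y
    rwa [map_zero, AddSubgroup.coe_zero, zero_add] at this
  have hg₁ : ∀ i x, (g₁ (Finsupp.single i x) : I →₀ pMod A B U C₁ C₂) =
      Finsupp.single i ⟨x, 0⟩ := fun i x => by simp only [g₁, Finsupp.lsum_single]; rfl
  have hg₂ : ∀ i y, (g₂ (Finsupp.single i y) : I →₀ pMod A B U C₁ C₂) =
      Finsupp.single i ⟨0, (0, y)⟩ := fun i y => by simp only [g₂, Finsupp.lsum_single]; rfl
  -- Both composites are compared with the identity on the generators coming from `C₁` and `C₂`.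
  refine ⟨LinearEquiv.ofLinearMap α β (pMod_hom_ext (fun x => ?_) fun y => ?_)
    (Finsupp.lhom_ext' fun i => pMod_hom_ext (fun x => ?_) fun y => ?_)⟩
  · rw [LinearMap.comp_apply, hβ₁, LinearMap.id_apply]
    induction x using Finsupp.induction_linear with
    | zero => simp; rfl
    | add x x' h h' =>
      rw [map_add, AddSubgroup.coe_add, map_add, h, h']
      exact TriMod.ext rfl (add_zero _)
    | single i x => rw [hg₁, hα₁]
  · rw [LinearMap.comp_apply, hβ₂, LinearMap.id_apply]
    induction y using Finsupp.induction_linear with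
    | zero => simp; rfl
    | add x x' h h' =>
      rw [map_add, AddSubgroup.coe_add, map_add, h, h']
      exact TriMod.ext (add_zero _) (Prod.ext (add_zero _) rfl)
    | single i x => rw [hg₂, hα₂]
  · simp only [LinearMap.comp_apply, Finsupp.lsingle_apply, LinearMap.id_apply]
    rw [hα₁, hβ₁, hg₁]
  · simp only [LinearMap.comp_apply, Finsupp.lsingle_apply, LinearMap.id_apply]
    rw [hα₂, hβ₂, hg₂]

theorem inAdd_pMod_iff {C₁ C₂ : Type u} [AddCommGroup C₁] [Module A C₁] [AddCommGroup C₂]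
    [Module B C₂] : InAdd (R := TriRing A B U) (pMod A B U C₁ C₂) N ↔
      ∃ I : Type u, IsRetract (TriRing A B U) N (pMod A B U (I →₀ C₁) (I →₀ C₂)) := by
  rw [inAdd_iff_isRetract]
  refine exists_congr fun I => ?_
  obtain ⟨e⟩ := finsupp_pMod_equiv A B U I C₁ C₂
  exact ⟨fun h => h.trans (.of_equiv e), fun h => h.trans (.of_equiv e.symm)⟩

/-- `p(L', Y)` is the direct sum of `(L', U ⊗ L')` and `(0, Y)`; this lemma and the next use one
summand each. -/
theorem isRetract_pFree (h : IsRetract A L L') :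
    IsRetract (TriRing A B U) (pFree A B U L) (pMod A B U L' Y) := by
  obtain ⟨i, r, hr⟩ := h
  refine ⟨TriMod.map i (LinearMap.inl B _ _ ∘ₗ lTensor A B U i) rfl,
    TriMod.map r (lTensor A B U r ∘ₗ LinearMap.fst B _ _) rfl, pFree_hom_ext fun x => ?_⟩
  refine TriMod.ext (LinearMap.congr_fun hr x) ?_
  simp [TriMod.map]

theorem isRetract_zMod (h : IsRetract B Y Y') :
    IsRetract (TriRing A B U) (zMod A B U Y) (pMod A B U L Y') := by
  obtain ⟨i, r, hr⟩ := h
  refine ⟨TriMod.map 0 (LinearMap.inr B _ _ ∘ₗ i) (by rw [lTensor_zero]; simp),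
    TriMod.map 0 (r ∘ₗ LinearMap.snd B _ _) (by rw [LinearMap.comp_assoc]; simp),
    zMod_hom_ext fun x => ?_⟩
  exact TriMod.ext rfl (LinearMap.congr_fun hr x)

theorem IsRetract.fst (h : IsRetract (TriRing A B U) N (pMod A B U L Y)) :
    IsRetract A (Fst A B U N) L := by
  obtain ⟨i, r, hr⟩ := h
  refine IsRetract.trans ⟨fstMap i, fstMap r, ?_⟩ (.of_equiv (TriMod.fstEquiv _))
  rw [← fstMap_comp, hr]; rfl

theorem IsRetract.snd (h : IsRetract (TriRing A B U) N (pMod A B U L Y)) :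
    IsRetract B (Snd A B U N) (BTensor A B U L × Y) := by
  obtain ⟨i, r, hr⟩ := h
  refine IsRetract.trans ⟨sndMap i, sndMap r, ?_⟩ (.of_equiv (TriMod.sndEquiv _))
  rw [← sndMap_comp, hr]; rfl

variable (A B U N) in
/-- The cokernel of the structure map of a `T`-module. -/
abbrev Cok : Type u := Snd A B U N ⧸ LinearMap.range (phi A B U N)

theorem mkQ_phi (t : BTensor A B U (Fst A B U N)) :
    (LinearMap.range (phi A B U N)).mkQ (phi A B U N t) = 0 :=
  (Submodule.Quotient.mk_eq_zero _).2 ⟨t, rfl⟩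

/-- The map induced by a `T`-linear map on the cokernels of the structure maps. -/
def cokMap (f : N →ₗ[TriRing A B U] N') : Cok A B U N →ₗ[B] Cok A B U N' :=
  Submodule.mapQ _ _ (sndMap f) (by
    rintro _ ⟨t, rfl⟩
    exact ⟨_, (sndMap_phi f t).symm⟩)

theorem cokMap_mkQ (f : N →ₗ[TriRing A B U] N') (y : Snd A B U N) :
    cokMap f ((LinearMap.range (phi A B U N)).mkQ y) =
      (LinearMap.range (phi A B U N')).mkQ (sndMap f y) := rfl

/-- The map `N → (0, Y)` induced by `Cok N → Y`. -/
def zModLift (g : Cok A B U N →ₗ[B] Y) : N →ₗ[TriRing A B U] zMod A B U Y :=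
  TriMod.lift 0 (g ∘ₗ (LinearMap.range (phi A B U N)).mkQ) (by
    refine LinearMap.ext fun t => ?_
    rw [LinearMap.comp_apply, LinearMap.comp_apply, mkQ_phi, map_zero]; rfl)

theorem zModLift_apply (g : Cok A B U N →ₗ[B] Y) (x : N) :
    zModLift g x = ⟨0, g ((LinearMap.range (phi A B U N)).mkQ (projSnd x))⟩ := rfl

/-- The map `Cok N → Y` induced by `N → (0, Y)`. -/
def zModColift (f : N →ₗ[TriRing A B U] zMod A B U Y) : Cok A B U N →ₗ[B] Y :=
  Submodule.liftQ _ ((TriMod.sndEquiv _).toLinearMap ∘ₗ sndMap f) (by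
    rintro _ ⟨t, rfl⟩
    rw [LinearMap.mem_ker, LinearMap.comp_apply, sndMap_phi]
    exact TriMod.sndEquiv_phi _)

theorem cok_hom_ext {f g : Cok A B U N →ₗ[B] Y}
    (h : ∀ y, f ((LinearMap.range (phi A B U N)).mkQ y) =
      g ((LinearMap.range (phi A B U N)).mkQ y)) : f = g :=
  Submodule.linearMap_qext _ (LinearMap.ext h)

/-- The cokernel of the structure map is functorial, and for `p(L, Y)` it is `Y`. -/
theorem IsRetract.cok (h : IsRetract (TriRing A B U) N (pMod A B U L Y)) :
    IsRetract B (Cok A B U N) Y := by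
  obtain ⟨i, r, hr⟩ := h
  refine ⟨Submodule.liftQ _ (LinearMap.snd B _ _ ∘ₗ (TriMod.sndEquiv _).toLinearMap ∘ₗ sndMap i) ?_,
    (LinearMap.range (phi A B U N)).mkQ ∘ₗ sndMap r ∘ₗ (TriMod.sndEquiv _).symm.toLinearMap ∘ₗ
      LinearMap.inr B _ _, cok_hom_ext fun y => ?_⟩
  · rintro _ ⟨t, rfl⟩
    rw [LinearMap.mem_ker, LinearMap.comp_apply, LinearMap.comp_apply, sndMap_phi]
    exact congrArg Prod.snd (TriMod.sndEquiv_phi _)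
  · let e := TriMod.sndEquiv (LinearMap.inl B (BTensor A B U L) Y)
    obtain ⟨s, hs⟩ := lTensor_surjective (A := A) (B := B) (U := U)
      (TriMod.fstEquiv (LinearMap.inl B (BTensor A B U L) Y)).surjective (e (sndMap i y)).1
    -- The `U ⊗ L` part of `sndMap i y` is in the image of the structure map, so modulo that image
    -- only the `Y` part survives the retraction.
    have hy : y = sndMap r (e.symm (LinearMap.inr B _ _ (e (sndMap i y)).2)) +
        phi A B U N (lTensor A B U (fstMap r) s) := by
      rw [← sndMap_phi, ← map_add]
      have h1 : e.symm (LinearMap.inr B _ _ (e (sndMap i y)).2) + phi A B U _ s = sndMap i y := by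
        apply e.injective
        rw [map_add, e.apply_symm_apply, TriMod.sndEquiv_phi]
        refine Prod.ext ?_ ?_
        · exact (zero_add _).trans hs
        · exact add_zero _
      rw [h1]
      exact Subtype.ext (LinearMap.congr_fun hr (y : N)).symm
    rw [LinearMap.id_apply]
    conv_rhs => rw [hy, map_add, mkQ_phi, add_zero]
    rfl

/-- If `N` is a retract of some `p(L', Y)`, then maps out of its first component extend. -/
theorem IsRetract.exists_fstMap_eq (h : IsRetract (TriRing A B U) N (pMod A B U L' Y))
    (g : Fst A B U N →ₗ[A] L) : ∃ k : N →ₗ[TriRing A B U] pFree A B U L,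
      (TriMod.fstEquiv _).toLinearMap ∘ₗ fstMap k = g := by
  obtain ⟨i, r, hr⟩ := h
  let e := (TriMod.fstEquiv (LinearMap.inl B (BTensor A B U L') Y))
  let g' : L' →ₗ[A] L := g ∘ₗ fstMap r ∘ₗ e.symm.toLinearMap
  refine ⟨TriMod.map g' (lTensor A B U g' ∘ₗ LinearMap.fst B _ _) rfl ∘ₗ i, ?_⟩
  refine LinearMap.ext fun x => ?_
  change g (fstMap r (e.symm (e (fstMap i x)))) = g x
  rw [e.symm_apply_apply]
  exact congrArg g (Subtype.ext (LinearMap.congr_fun hr (x : N)))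

/-- Extending the identity of `N₁` to a map `N → (N₁, U ⊗ N₁)` gives, on second components, a left
inverse of `phi`. -/
theorem IsRetract.phi_injective (h : IsRetract (TriRing A B U) N (pMod A B U L Y)) :
    Function.Injective (phi A B U N) := by
  obtain ⟨k, hk⟩ := h.exists_fstMap_eq LinearMap.id
  rw [injective_iff_map_eq_zero]
  intro t ht
  have h1 := congrArg (TriMod.sndEquiv _) (sndMap_phi k t)
  rw [ht, map_zero, map_zero, TriMod.sndEquiv_phi, lTensor_comp_apply, hk, lTensor_id] at h1
  exact h1.symm

/-- The canonical map `p(N₁, N₂) → N` is onto, hence splits. -/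
theorem isRetract_pMod_of_projective [Module.Projective (TriRing A B U) N] :
    IsRetract (TriRing A B U) N (pMod A B U (Fst A B U N) (Snd A B U N)) := by
  obtain ⟨s, hs⟩ := Module.projective_lifting_property
    (pModDesc (N := N) (LinearMap.id : Fst A B U N →ₗ[A] _) (LinearMap.id : Snd A B U N →ₗ[B] _))
    LinearMap.id (fun x => ⟨⟨projFst x, (0, projSnd x)⟩, by
      rw [pModDesc_mk]; exact projFst_add_projSnd A B U x⟩)
  exact ⟨s, _, hs⟩

/-- `N ↦ N₁` is left adjoint to `M ↦ (M, 0)`, which preserves surjections. -/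
theorem projective_fst [Module.Projective (TriRing A B U) N] :
    Module.Projective A (Fst A B U N) := by
  refine Module.Projective.of_lifting_property fun {M M'} _ _ _ _ f g hf => ?_
  let q : ∀ (X : Type u) [AddCommGroup X] [Module A X], BTensor A B U X →ₗ[B] PUnit.{u + 1} :=
    fun X _ _ => 0
  obtain ⟨k, hk⟩ := Module.projective_lifting_property
    (TriMod.map (φ := q M) (ψ := q M') f LinearMap.id (by rfl))
    (TriMod.lift (N := N) (φ := q M') g 0 (by rfl)) (fun m => by
      obtain ⟨x, hx⟩ := hf m.fst
      exact ⟨⟨x, 0⟩, TriMod.ext hx rfl⟩)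
  refine ⟨(TriMod.fstEquiv _).toLinearMap ∘ₗ fstMap k, LinearMap.ext fun x => ?_⟩
  have := congrArg TriMod.fst (LinearMap.congr_fun hk (x : N))
  rw [TriMod.lift_apply, projFst_coe] at this
  exact this

/-- `Cok` is left adjoint to `Y ↦ (0, Y)`, which preserves surjections. -/
theorem projective_cok [Module.Projective (TriRing A B U) N] :
    Module.Projective B (Cok A B U N) := by
  refine Module.Projective.of_lifting_property fun {M M'} _ _ _ _ f g hf => ?_
  obtain ⟨k, hk⟩ := Module.projective_lifting_property (zModMap f : zMod A B U M →ₗ[_] _)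
    (zModLift g) (fun m => by
      obtain ⟨x, hx⟩ := hf m.snd
      exact ⟨⟨0, x⟩, TriMod.ext rfl hx⟩)
  refine ⟨zModColift k, cok_hom_ext fun y => ?_⟩
  have := congrArg TriMod.snd (LinearMap.congr_fun hk (y : N))
  rw [zModLift_apply, projSnd_coe] at this
  exact this

/-- The right adjoint `N ↦ N₁` preserves surjections; for `projective_zMod` it is `N ↦ N₂`. -/
theorem projective_pFree [Module.Projective A L] :
    Module.Projective (TriRing A B U) (pFree A B U L) := by
  refine Module.Projective.of_lifting_property fun {M M'} _ _ _ _ f g hf => ?_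
  obtain ⟨k, hk⟩ := Module.projective_lifting_property (fstMap f) (pFreeRes g)
    (fstMap_surjective hf)
  refine ⟨pFreeDesc k, pFree_hom_ext fun x => ?_⟩
  rw [LinearMap.comp_apply, pFreeDesc_mk]
  exact congrArg Subtype.val (LinearMap.congr_fun hk x)

theorem projective_zMod [Module.Projective B Y] :
    Module.Projective (TriRing A B U) (zMod A B U Y) := by
  refine Module.Projective.of_lifting_property fun {M M'} _ _ _ _ f g hf => ?_
  obtain ⟨k, hk⟩ := Module.projective_lifting_property (sndMap f) (zModRes g)
    (sndMap_surjective hf)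
  refine ⟨zModDesc k, zMod_hom_ext fun x => ?_⟩
  rw [LinearMap.comp_apply, zModDesc_apply]
  exact congrArg Subtype.val (LinearMap.congr_fun hk x)

end TriAdd

end RelGor

namespace RelGor

/-! ### `G_C`-projective modules over the triangular matrix ring -/

section TriGor

variable {A B U : Type u} [Ring A] [Ring B] [AddCommGroup U] [Module B U] [Module Aᵐᵒᵖ U]
  [SMulCommClass B Aᵐᵒᵖ U]
variable {C₁ C₂ : Type u} [AddCommGroup C₁] [Module A C₁] [AddCommGroup C₂] [Module B C₂]

theorem pFreeMap_mk {L L' : Type u} [AddCommGroup L] [Module A L] [AddCommGroup L'] [Module A L']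
    (f : L →ₗ[A] L') (x : L) : pFreeMap f (⟨x, 0⟩ : pFree A B U L) = ⟨f x, 0⟩ :=
  TriMod.ext rfl (map_zero (lTensor A B U f))

theorem pFreeMap_comp {L L' L'' : Type u} [AddCommGroup L] [Module A L] [AddCommGroup L']
    [Module A L'] [AddCommGroup L''] [Module A L''] (g : L' →ₗ[A] L'') (f : L →ₗ[A] L') :
    (pFreeMap (g ∘ₗ f) : pFree A B U L →ₗ[TriRing A B U] _) = pFreeMap g ∘ₗ pFreeMap f :=
  LinearMap.ext fun m => TriMod.ext rfl (lTensor_comp_apply g f m.snd).symm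

theorem pFreeMap_exact {L L' L'' : Type u} [AddCommGroup L] [Module A L] [AddCommGroup L']
    [Module A L'] [AddCommGroup L''] [Module A L''] {f : L →ₗ[A] L'} {g : L' →ₗ[A] L''}
    (h : Function.Exact f g) (hT : Function.Exact (lTensor A B U f) (lTensor A B U g)) :
    Function.Exact (pFreeMap f : pFree A B U L →ₗ[TriRing A B U] _) (pFreeMap g) := by
  intro m
  constructor
  · intro hm
    obtain ⟨x, hx⟩ := (h m.fst).1 (congrArg TriMod.fst hm)
    obtain ⟨y, hy⟩ := (hT m.snd).1 (congrArg TriMod.snd hm)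
    exact ⟨⟨x, y⟩, TriMod.ext hx hy⟩
  · rintro ⟨x, rfl⟩
    exact TriMod.ext (h.apply_apply_eq_zero _) (hT.apply_apply_eq_zero _)

variable (B U) in
/-- The sequence `(S, U ⊗_A S)` of `T`-modules. -/
abbrev LongSeq.pFree (S : LongSeq A) : LongSeq (TriRing A B U) where
  X n := ModuleCat.of _ (RelGor.pFree A B U (S.X n))
  d n := pFreeMap (S.d n)

variable (A U) in
/-- The sequence `(0, S)` of `T`-modules. -/
abbrev LongSeq.zMod (S : LongSeq B) : LongSeq (TriRing A B U) where
  X n := ModuleCat.of _ (RelGor.zMod A B U (S.X n))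
  d n := zModMap (S.d n)

/-- The first components of a sequence of `T`-modules. -/
abbrev LongSeq.fst (S : LongSeq (TriRing A B U)) : LongSeq A where
  X n := ModuleCat.of A (Fst A B U (S.X n))
  d n := fstMap (S.d n)

/-- The cokernels of the structure maps of a sequence of `T`-modules. -/
abbrev LongSeq.cok (S : LongSeq (TriRing A B U)) : LongSeq B where
  X n := ModuleCat.of B (Cok A B U (S.X n))
  d n := cokMap (S.d n)

theorem LongSeq.IsExact.pFree {S : LongSeq A} (hS : S.IsExact)
    (hT : ∀ n : ℤ, Function.Exact (lTensor A B U (S.d n)) (lTensor A B U (S.d (n + 1)))) :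
    (S.pFree B U).IsExact :=
  fun n => pFreeMap_exact (hS n) (hT n)

/-- By adjunction, `Hom_T((S, U ⊗ S), F)` is `Hom_A(S, F₁)`. -/
theorem LongSeq.IsHomExact.pFree {S : LongSeq A} (hS : S.IsExact)
    (hS' : (S.pFree B U).IsExact) {F : Type u} [AddCommGroup F] [Module (TriRing A B U) F]
    (hF : S.IsHomExact (Fst A B U F)) : (S.pFree B U).IsHomExact F := by
  rw [LongSeq.isHomExact_iff hS']
  intro n (g : RelGor.pFree A B U (S.X (n + 1)) →ₗ[TriRing A B U] F) hg
  obtain ⟨k, hk⟩ := (LongSeq.isHomExact_iff hS _).1 hF n (pFreeRes g) (LinearMap.ext fun x => by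
    refine Subtype.ext ?_
    have h1 : g (pFreeMap (S.d n) (⟨x, 0⟩ : RelGor.pFree A B U (S.X n))) = 0 :=
      LinearMap.congr_fun hg _
    rw [pFreeMap_mk] at h1
    exact h1)
  refine ⟨pFreeDesc k, pFree_hom_ext fun x => ?_⟩
  change pFreeDesc k (pFreeMap (S.d (n + 1)) (⟨x, 0⟩ : RelGor.pFree A B U (S.X (n + 1)))) = _
  rw [pFreeMap_mk, pFreeDesc_mk]
  exact congrArg Subtype.val (LinearMap.congr_fun hk x)

/-- Condition (a) keeps the sequence exact after applying `L ↦ (L, U ⊗ L)`, and first components of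
modules in `Add(p(C₁, C₂))` lie in `Add(C₁)`. -/
theorem gProj_pFree (hU : IsCompatible A B U C₁ C₂) {X : Type u} [AddCommGroup X] [Module A X]
    (hX : GProj A C₁ (ModuleCat.of A X)) :
    GProj (TriRing A B U) (pMod A B U C₁ C₂) (ModuleCat.of _ (pFree A B U X)) := by
  obtain ⟨S, hS, hSC, hSP, p, i, hp, hi, hip⟩ := gProj_iff.1 hX
  have hT := hU.tensor_exact S hS hSP
  have hS' := hS.pFree hT
  refine gProj_iff.2 ⟨S.pFree B U, hS', ?_, ⟨fun n hn => ?_, fun n hn => ?_⟩,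
    pFreeMap p, pFreeMap i, fun m => ?_, ?_, ?_⟩
  · intro F hF
    obtain ⟨I, hI⟩ := inAdd_pMod_iff.1 hF
    exact .pFree hS hS' (hSC (ModuleCat.of A (Fst A B U F))
      ((inAdd_finsupp C₁ I).of_isRetract hI.fst))
  · have := hSP.1 n hn
    exact projective_pFree
  · obtain ⟨I, hI⟩ := inAdd_iff_isRetract.1 (hSP.2 n hn)
    exact inAdd_pMod_iff.2 ⟨I, isRetract_pFree hI⟩
  · obtain ⟨x, hx⟩ := hp m.fst
    obtain ⟨y, hy⟩ := lTensor_surjective (A := A) (B := B) (U := U) hp m.snd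
    exact ⟨⟨x, y⟩, TriMod.ext hx hy⟩
  · intro m m' h
    exact TriMod.ext (hi (congrArg TriMod.fst h))
      (lTensor_injective_of_exact hS hT hp hi hip (congrArg TriMod.snd h))
  · change pFreeMap i ∘ₗ pFreeMap p = pFreeMap (S.d (-1))
    rw [← hip]
    exact (pFreeMap_comp i p).symm

/-- `Hom_T((0, S), F)` is `Hom_B(S, F₂)`. For `F` in `Add(p(C₁, C₂))`, `F₂` is a retract of `(U ⊗
C₁^(I)) × C₂^(I)`: condition (b) handles the first factor, the hypothesis on `S` the second. -/
theorem gProj_zMod (hU : IsCompatible A B U C₁ C₂) {Y : Type u} [AddCommGroup Y] [Module B Y]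
    (hY : GProj B C₂ (ModuleCat.of B Y)) :
    GProj (TriRing A B U) (pMod A B U C₁ C₂) (ModuleCat.of _ (zMod A B U Y)) := by
  obtain ⟨S, hS, hSC, hSP, p, i, hp, hi, hip⟩ := gProj_iff.1 hY
  have hS' : (S.zMod A U).IsExact := fun n => by
    intro m
    constructor
    · intro hm
      obtain ⟨y, hy⟩ := (hS n m.snd).1 (congrArg TriMod.snd hm)
      exact ⟨⟨0, y⟩, TriMod.ext rfl hy⟩
    · rintro ⟨x, rfl⟩
      exact TriMod.ext rfl (hS.comp n _)
  refine gProj_iff.2 ⟨S.zMod A U, hS', ?_, ⟨fun n hn => ?_, fun n hn => ?_⟩,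
    zModMap p, zModMap i, fun m => ?_, ?_, ?_⟩
  · intro F hF
    rw [LongSeq.isHomExact_iff hS']
    intro n (g : RelGor.zMod A B U (S.X (n + 1)) →ₗ[TriRing A B U] F) hg
    obtain ⟨I, hI⟩ := inAdd_pMod_iff.1 hF
    have hF2 : S.IsHomExact (Snd A B U F) := by
      refine LongSeq.IsHomExact.of_isRetract hS (LongSeq.IsHomExact.prod hS ?_ ?_) hI.snd
      · exact hU.hom_exact S hS hSC hSP (ModuleCat.of A (I →₀ C₁)) (inAdd_finsupp C₁ I)
      · exact hSC (ModuleCat.of B (I →₀ C₂)) (inAdd_finsupp C₂ I)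
    obtain ⟨k, hk⟩ := (LongSeq.isHomExact_iff hS _).1 hF2 n (zModRes g) (LinearMap.ext fun x =>
      Subtype.ext (LinearMap.congr_fun hg (⟨0, x⟩ : RelGor.zMod A B U (S.X n))))
    refine ⟨zModDesc k, zMod_hom_ext fun x => ?_⟩
    rw [LinearMap.comp_apply]
    refine (zModDesc_apply k _).trans ?_
    exact congrArg Subtype.val (LinearMap.congr_fun hk x)
  · have := hSP.1 n hn
    exact projective_zMod
  · obtain ⟨I, hI⟩ := inAdd_iff_isRetract.1 (hSP.2 n hn)
    exact inAdd_pMod_iff.2 ⟨I, isRetract_zMod hI⟩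
  · obtain ⟨x, hx⟩ := hp m.snd
    exact ⟨⟨0, x⟩, TriMod.ext rfl hx⟩
  · intro m m' h
    exact TriMod.ext rfl (hi (congrArg TriMod.snd h))
  · exact LinearMap.ext fun m => TriMod.ext rfl (LinearMap.congr_fun hip m.snd)

/-- A uniform description of the projective and the `Add` terms, enough for injectivity of `phi` and
for extending maps off first components. -/
theorem LongSeq.IsProjAdd.isRetract {S : LongSeq (TriRing A B U)}
    (h : S.IsProjAdd (pMod A B U C₁ C₂)) (n : ℤ) : ∃ (L : ModuleCat.{u} A) (Y : ModuleCat.{u} B),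
      IsRetract (TriRing A B U) (S.X n) (pMod A B U L Y) := by
  rcases lt_or_ge n 0 with hn | hn
  · have := h.1 n hn
    exact ⟨ModuleCat.of A (Fst A B U (S.X n)), ModuleCat.of B (Snd A B U (S.X n)),
      isRetract_pMod_of_projective⟩
  · obtain ⟨I, hI⟩ := inAdd_pMod_iff.1 (h.2 n hn)
    exact ⟨ModuleCat.of A (I →₀ C₁), ModuleCat.of B (I →₀ C₂), hI⟩

theorem LongSeq.IsProjAdd.fst {S : LongSeq (TriRing A B U)}
    (h : S.IsProjAdd (pMod A B U C₁ C₂)) : S.fst.IsProjAdd C₁ := by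
  refine ⟨fun n hn => ?_, fun n hn => ?_⟩
  · have := h.1 n hn
    exact projective_fst
  · obtain ⟨I, hI⟩ := inAdd_pMod_iff.1 (h.2 n hn)
    exact (inAdd_finsupp C₁ I).of_isRetract hI.fst

theorem LongSeq.IsProjAdd.cok {S : LongSeq (TriRing A B U)}
    (h : S.IsProjAdd (pMod A B U C₁ C₂)) : S.cok.IsProjAdd C₂ := by
  refine ⟨fun n hn => ?_, fun n hn => ?_⟩
  · have := h.1 n hn
    exact projective_cok
  · obtain ⟨I, hI⟩ := inAdd_pMod_iff.1 (h.2 n hn)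
    exact (inAdd_finsupp C₂ I).of_isRetract hI.cok

/-- The sequences `0 → U ⊗ S₁ → S₂ → Cok S → 0` are exact, and the first two complexes are exact,
hence so is the third. -/
theorem LongSeq.IsExact.cok {S : LongSeq (TriRing A B U)} (hS : S.IsExact)
    (hφ : ∀ n, Function.Injective (phi A B U (S.X n)))
    (hT : ∀ n : ℤ, Function.Exact (lTensor A B U (S.fst.d n)) (lTensor A B U (S.fst.d (n + 1)))) :
    S.cok.IsExact := by
  intro n c
  obtain ⟨y, rfl⟩ := (LinearMap.range (phi A B U (S.X (n + 1)))).mkQ_surjective c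
  constructor
  · intro hy
    obtain ⟨t, ht⟩ := (Submodule.Quotient.mk_eq_zero _).1 hy
    have ht' : lTensor A B U (fstMap (S.d (n + 1 + 1))) t = 0 := by
      apply hφ
      rw [← sndMap_phi, ht, map_zero]
      exact Subtype.ext (hS.comp (n + 1) _)
    obtain ⟨s, rfl⟩ := (hT (n + 1) t).1 ht'
    have h1 : sndMap (S.d (n + 1)) (y - phi A B U _ s) = 0 := by
      rw [map_sub, sndMap_phi, sub_eq_zero]
      exact ht.symm
    obtain ⟨z, hz⟩ := (sndMap_exact (hS n) _).1 h1
    refine ⟨(LinearMap.range (phi A B U (S.X n))).mkQ z, ?_⟩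
    refine (cokMap_mkQ (S.d n) z).trans ?_
    rw [hz, map_sub, mkQ_phi, sub_zero]
  · rintro ⟨c', hc⟩
    obtain ⟨z, rfl⟩ := (LinearMap.range (phi A B U (S.X n))).mkQ_surjective c'
    rw [← hc]
    refine (Submodule.Quotient.mk_eq_zero _).2 ?_
    rw [show sndMap (S.d (n + 1)) (sndMap (S.d n) z) = 0 from Subtype.ext (hS.comp n _)]
    exact Submodule.zero_mem _

/-- `Hom_B(Cok S, F)` is `Hom_T(S, (0, F))`, and `(0, F)` lies in `Add(p(C₁, C₂))` when `F` lies in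
`Add(C₂)`. -/
theorem LongSeq.IsHomAddExact.cok {S : LongSeq (TriRing A B U)} (hS : S.IsExact)
    (hS' : S.cok.IsExact) (h : S.IsHomAddExact (pMod A B U C₁ C₂)) :
    S.cok.IsHomAddExact C₂ := by
  intro F hF
  rw [LongSeq.isHomExact_iff hS']
  intro n (g : Cok A B U (S.X (n + 1)) →ₗ[B] F) hg
  obtain ⟨I, hI⟩ := inAdd_iff_isRetract.1 hF
  have hF' := h (ModuleCat.of _ (RelGor.zMod A B U F)) (inAdd_pMod_iff.2 ⟨I, isRetract_zMod hI⟩)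
  obtain ⟨k, hk⟩ := (LongSeq.isHomExact_iff hS _).1 hF' n (zModLift g) (LinearMap.ext fun x => by
    rw [LinearMap.comp_apply]
    refine (zModLift_apply g _).trans (TriMod.ext rfl ?_)
    rw [projSnd_map]
    exact LinearMap.congr_fun hg ((LinearMap.range (phi A B U (S.X n))).mkQ (projSnd x)))
  refine ⟨zModColift k, cok_hom_ext fun y => ?_⟩
  have := congrArg TriMod.snd (LinearMap.congr_fun hk (y : S.X (n + 1)))
  refine this.trans ?_
  refine (congrArg TriMod.snd (zModLift_apply g _)).trans ?_
  rw [projSnd_coe]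

/-- A map `g` on first components extends to `k` with values in `(F, U ⊗ F)`, which lies in
`Add(p(C₁, C₂))`. The extension need not kill the previous differential, but the error lies in `(0,
U ⊗ F)`. Condition (b), applied to `Cok S`, provides a correction that leaves first components
unchanged. -/
theorem LongSeq.IsHomAddExact.fst (hU : IsCompatible A B U C₁ C₂) {S : LongSeq (TriRing A B U)}
    (hS : S.IsExact) (hS₁ : S.fst.IsExact) (hS₂ : S.cok.IsExact)
    (hP : S.IsProjAdd (pMod A B U C₁ C₂)) (h : S.IsHomAddExact (pMod A B U C₁ C₂)) :
    S.fst.IsHomAddExact C₁ := by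
  intro F hF
  rw [LongSeq.isHomExact_iff hS₁]
  intro n (g : Fst A B U (S.X (n + 1)) →ₗ[A] F) hg
  obtain ⟨I, hI⟩ := inAdd_iff_isRetract.1 hF
  have hF' := h (ModuleCat.of _ (RelGor.pFree A B U F)) (inAdd_pMod_iff.2 ⟨I, isRetract_pFree hI⟩)
  have hUF := hU.hom_exact S.cok hS₂ (LongSeq.IsHomAddExact.cok hS hS₂ h) hP.cok F hF
  obtain ⟨L, Y, hr⟩ := hP.isRetract (n + 1)
  obtain ⟨k, hk⟩ := hr.exists_fstMap_eq g
  have hk' : ∀ x : Fst A B U (S.X (n + 1)), (k (x : S.X (n + 1))).fst = g x :=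
    fun x => LinearMap.congr_fun hk x
  let j : RelGor.zMod A B U (BTensor A B U F) →ₗ[TriRing A B U] RelGor.pFree A B U F :=
    TriMod.map 0 LinearMap.id (by rw [lTensor_zero])
  -- The composite of `k` with the previous differential lands in `(0, U ⊗ F)`.
  have hkd : ∀ x : S.X n, (k (S.d n x)).fst = 0 := fun x => by
    rw [← projFst_add_projSnd A B U (S.d n x), map_add, TriMod.add_fst, projFst_map]
    have h1 : (k (sndMap (S.d n) (projSnd x))).fst = 0 :=
      TriMod.mem_snd_iff.1 (sndMap k (sndMap (S.d n) (projSnd x))).2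
    rw [projSnd_map, h1, add_zero, hk']
    exact LinearMap.congr_fun hg (projFst x)
  -- Linearity over `T` rests on `hkd`: the `U`-entry of a matrix acts through the first component,
  -- which vanishes here.
  let v : S.X n →ₗ[TriRing A B U] RelGor.zMod A B U (BTensor A B U F) :=
    { toFun := fun x => ⟨0, (k (S.d n x)).snd⟩
      map_add' := fun x y => TriMod.ext rfl (by simp)
      map_smul' := fun t x => TriMod.ext rfl (by simp [hkd, tmul_zero]) }
  -- One more degree to the left is needed to see `v` as a cocycle in `Hom(Cok S, U ⊗ F)`; its
  -- preimage `w` lives on the cokernel in the degree of `k`.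
  obtain ⟨m, rfl⟩ : ∃ m : ℤ, m + 1 = n := ⟨n - 1, by omega⟩
  obtain ⟨w, hw⟩ := (LongSeq.isHomExact_iff hS₂ _).1 hUF m (zModColift v) (cok_hom_ext fun y => by
    change (k (S.d (m + 1) (S.d m y))).snd = 0
    rw [hS.comp, map_zero]; rfl)
  have hw' : ∀ x : S.X (m + 1), k (S.d (m + 1) x) = j (zModLift w (S.d (m + 1) x)) := fun x => by
    refine TriMod.ext (hkd x) ?_
    rw [zModLift_apply, projSnd_map]
    have h1 := LinearMap.congr_fun hw ((LinearMap.range (phi A B U (S.X (m + 1)))).mkQ (projSnd x))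
    refine Eq.trans ?_ h1.symm
    change _ = (k (S.d (m + 1) (projSnd x : S.X (m + 1)))).snd
    conv_lhs => rw [← projFst_add_projSnd A B U x, map_add, map_add, TriMod.add_snd]
    have h2 : (k (S.d (m + 1) (projFst x : S.X (m + 1)))).snd = 0 :=
      TriMod.mem_fst_iff.1 (fstMap k (fstMap (S.d (m + 1)) (projFst x))).2
    rw [h2, zero_add]
  -- The corrected map `k - j ∘ₗ zModLift w` kills the differential, so it extends; its first
  -- component is still `g`.
  obtain ⟨q, hq⟩ := (LongSeq.isHomExact_iff hS _).1 hF' (m + 1) (k - j ∘ₗ zModLift w)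
    (LinearMap.ext fun x => by
      simp only [LinearMap.comp_apply, LinearMap.sub_apply]
      rw [hw', sub_self]; rfl)
  refine ⟨(TriMod.fstEquiv _).toLinearMap ∘ₗ fstMap q, LinearMap.ext fun x => ?_⟩
  have h3 := congrArg TriMod.fst (LinearMap.congr_fun hq (x : S.X (m + 1 + 1)))
  refine h3.trans ?_
  rw [LinearMap.sub_apply, sub_eq_add_neg, TriMod.add_fst, hk']
  change g x + -0 = g x
  simp

/-- First components and cokernels of a defining sequence of `H` are defining sequences for `H₁` and
`Cok H`. What remains is to see that taking the image in degree `-1` commutes with these operations,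
which for cokernels uses exactness of the tensored sequence. -/
theorem gProj_fst_cok (hU : IsCompatible A B U C₁ C₂) {H : Type u} [AddCommGroup H]
    [Module (TriRing A B U) H]
    (hH : GProj (TriRing A B U) (pMod A B U C₁ C₂) (ModuleCat.of _ H)) :
    GProj A C₁ (ModuleCat.of A (Fst A B U H)) ∧ Function.Injective (phi A B U H) ∧
      GProj B C₂ (ModuleCat.of B (Cok A B U H)) := by
  obtain ⟨S, hS, hSC, hSP, p, i, hp, hi, hip⟩ := gProj_iff.1 hH
  have hS₁ : S.fst.IsExact := fun n => fstMap_exact (hS n)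
  have hT := hU.tensor_exact S.fst hS₁ hSP.fst
  have hφ : ∀ n, Function.Injective (phi A B U (S.X n)) := fun n => by
    obtain ⟨L, Y, hr⟩ := hSP.isRetract n
    exact hr.phi_injective
  have hS₂ : S.cok.IsExact := hS.cok hφ hT
  have hip₁ : fstMap i ∘ₗ fstMap p = S.fst.d (-1) := by rw [← fstMap_comp, hip]
  have hTi : Function.Injective (lTensor A B U (fstMap i)) :=
    lTensor_injective_of_exact hS₁ hT (fstMap_surjective hp) (fstMap_injective hi) hip₁
  refine ⟨gProj_iff.2 ⟨S.fst, hS₁, .fst hU hS hS₁ hS₂ hSP hSC, hSP.fst, fstMap p, fstMap i,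
    fstMap_surjective hp, fstMap_injective hi, hip₁⟩, ?_,
    gProj_iff.2 ⟨S.cok, hS₂, .cok hS hS₂ hSC, hSP.cok, cokMap p, cokMap i, ?_, ?_, ?_⟩⟩
  -- `H` embeds in the degree `0` term, whose structure map is injective, and `U ⊗ -` preserves the
  -- embedding of first components.
  · intro t t' h
    apply hTi
    apply hφ
    rw [← sndMap_phi, h, sndMap_phi]
  · intro c
    obtain ⟨y, rfl⟩ := (LinearMap.range (phi A B U H)).mkQ_surjective c
    obtain ⟨z, rfl⟩ := sndMap_surjective hp y
    exact ⟨(LinearMap.range (phi A B U (S.X (-1)))).mkQ z, rfl⟩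
  · rw [injective_iff_map_eq_zero]
    intro c hc
    obtain ⟨y, rfl⟩ := (LinearMap.range (phi A B U H)).mkQ_surjective c
    obtain ⟨t, ht⟩ := (Submodule.Quotient.mk_eq_zero _).1 hc
    -- If `i y` equals `phi t`, then `t` is a cycle of `U ⊗ S₁`, hence a boundary from degree `-1`;
    -- pushing that element through `p` shows that `y` lies in the image of `phi`.
    have ht' : lTensor A B U (fstMap (S.d (-1 + 1))) t = 0 := by
      apply hφ
      rw [← sndMap_phi, ht, map_zero]
      obtain ⟨z, rfl⟩ := sndMap_surjective hp y
      refine Subtype.ext ?_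
      have h1 : i (p (z : S.X (-1))) = S.d (-1) z := LinearMap.congr_fun hip _
      change S.d (-1 + 1) (i (p (z : S.X (-1)))) = 0
      rw [h1, hS.comp]
    obtain ⟨s, rfl⟩ := (hT (-1) t).1 ht'
    refine (Submodule.Quotient.mk_eq_zero _).2 ⟨lTensor A B U (fstMap p) s, ?_⟩
    apply sndMap_injective hi
    rw [sndMap_phi, lTensor_comp_apply, hip₁, ht]
  · refine cok_hom_ext fun y => ?_
    change (LinearMap.range _).mkQ (sndMap i (sndMap p y)) = (LinearMap.range _).mkQ _
    rw [show sndMap i (sndMap p y) = sndMap (S.d (-1)) y from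
      Subtype.ext (LinearMap.congr_fun hip _)]

end TriGor

end RelGor

namespace RelGor

/-! ### Comparison of `Ext¹` over `T` with `Ext¹` over `A` and `B` -/

section TriExt

open Abelian

variable {A B U : Type u} [Ring A] [Ring B] [AddCommGroup U] [Module B U] [Module Aᵐᵒᵖ U]
  [SMulCommClass B Aᵐᵒᵖ U]
variable {C₁ C₂ : Type u} [AddCommGroup C₁] [Module A C₁] [AddCommGroup C₂] [Module B C₂]
variable {N : Type u} [AddCommGroup N] [Module (TriRing A B U) N]

/-- `ker p` is the preceding syzygy of `S`, so its inclusion is again preserved by `U ⊗ -`; when `p`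
is onto and `S.X m` is projective this is the vanishing of `Tor₁(U, X)`. -/
theorem lTensor_ker_injective_of_exact {X : Type u} [AddCommGroup X] [Module A X] {S : LongSeq A}
    (hS : S.IsExact)
    (hT : ∀ n : ℤ, Function.Exact (lTensor A B U (S.d n)) (lTensor A B U (S.d (n + 1))))
    {m : ℤ} {p : S.X m →ₗ[A] X} {i : X →ₗ[A] S.X (m + 1)} (hi : Function.Injective i)
    (hip : i ∘ₗ p = S.d m) : Function.Injective (lTensor A B U (LinearMap.ker p).subtype) := by
  obtain ⟨n, rfl⟩ : ∃ n : ℤ, n + 1 = m := ⟨m - 1, by omega⟩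
  have hker : ∀ x, p x = 0 ↔ S.d (n + 1) x = 0 := fun x => by
    rw [← hip, LinearMap.comp_apply, map_eq_zero_iff i hi]
  refine lTensor_injective_of_exact hS hT
    (p := (S.d n).codRestrict (LinearMap.ker p) fun x => (hker _).2 (hS.comp n x))
    (fun y => ?_) Subtype.val_injective rfl
  obtain ⟨x, hx⟩ := (hS n _).1 ((hker _).1 y.2)
  exact ⟨x, Subtype.ext hx⟩

/-- The presentation `0 → ker p → P → X → 0` taken from the defining sequence stays exact under `L ↦
(L, U ⊗ L)`, with projective middle term. The adjunction with `N ↦ N₁` identifies the two extension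
problems. -/
theorem ext_one_pFree_iff (hU : IsCompatible A B U C₁ C₂) {X : Type u} [AddCommGroup X]
    [Module A X] (hX : GProj A C₁ (ModuleCat.of A X)) :
    Subsingleton (Ext (ModuleCat.of (TriRing A B U) (pFree A B U X))
        (ModuleCat.of (TriRing A B U) N) 1) ↔
      Subsingleton (Ext (ModuleCat.of A X) (ModuleCat.of A (Fst A B U N)) 1) := by
  obtain ⟨S, hS, -, hSP, p, i, hp, hi, hip⟩ := gProj_iff.1 hX
  have hT := hU.tensor_exact S hS hSP
  have hker := lTensor_ker_injective_of_exact hS hT hi hip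
  have : Module.Projective A (S.X (-1)) := hSP.1 (-1) (by norm_num)
  have : Module.Projective (TriRing A B U) (pFree A B U (S.X (-1))) := projective_pFree
  have hex : Function.Exact (LinearMap.ker p).subtype p := LinearMap.exact_subtype_ker_map p
  have hex' := pFreeMap_exact hex (lTensor_exact (B := B) (U := U) hex hp)
  have hinj : Function.Injective (pFreeMap (LinearMap.ker p).subtype :
      pFree A B U (LinearMap.ker p) →ₗ[TriRing A B U] _) := fun m m' h =>
    TriMod.ext (Subtype.ext (congrArg TriMod.fst h)) (hker (congrArg TriMod.snd h))
  have hsurj : Function.Surjective (pFreeMap p : pFree A B U (S.X (-1)) →ₗ[TriRing A B U] _) :=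
    fun m => by
      obtain ⟨x, hx⟩ := hp m.fst
      obtain ⟨y, hy⟩ := lTensor_surjective (A := A) (B := B) (U := U) hp m.snd
      exact ⟨⟨x, y⟩, TriMod.ext hx hy⟩
  constructor
  · intro h
    refine ext_one_of_exists_extension Subtype.val_injective hex hp fun g => ?_
    obtain ⟨k, hk⟩ := exists_extension_of_ext_one hinj hex' hsurj h (pFreeDesc g)
    refine ⟨pFreeRes k, LinearMap.ext fun x => Subtype.ext ?_⟩
    have h1 := LinearMap.congr_fun hk ⟨x, 0⟩
    rw [LinearMap.comp_apply, pFreeMap_mk, pFreeDesc_mk] at h1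
    exact h1
  · intro h
    refine ext_one_of_exists_extension hinj hex' hsurj fun g => ?_
    obtain ⟨k, hk⟩ := exists_extension_of_ext_one Subtype.val_injective hex hp h (pFreeRes g)
    refine ⟨pFreeDesc k, pFree_hom_ext fun x => ?_⟩
    rw [LinearMap.comp_apply, pFreeMap_mk, pFreeDesc_mk]
    exact congrArg Subtype.val (LinearMap.congr_fun hk x)

/-- `Y ↦ (0, Y)` is exact, so any free cover of `Y` serves and no condition on `Y` is needed. -/
theorem ext_one_zMod_iff {Y : Type u} [AddCommGroup Y] [Module B Y] :
    Subsingleton (Ext (ModuleCat.of (TriRing A B U) (zMod A B U Y))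
        (ModuleCat.of (TriRing A B U) N) 1) ↔
      Subsingleton (Ext (ModuleCat.of B Y) (ModuleCat.of B (Snd A B U N)) 1) := by
  obtain ⟨P, _, p, hp⟩ : ∃ (P : ModuleCat.{u} B) (_ : Module.Projective B P) (p : P →ₗ[B] Y),
      Function.Surjective p :=
    ⟨ModuleCat.of B (Y →₀ B), inferInstanceAs (Module.Projective B (Y →₀ B)), _,
      Finsupp.linearCombination_id_surjective B Y⟩
  have : Module.Projective (TriRing A B U) (zMod A B U P) := projective_zMod
  have hex : Function.Exact (LinearMap.ker p).subtype p := LinearMap.exact_subtype_ker_map p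
  have hex' : Function.Exact (zModMap (LinearMap.ker p).subtype :
      zMod A B U (LinearMap.ker p) →ₗ[TriRing A B U] _) (zModMap p) := by
    intro m
    constructor
    · intro hm
      exact ⟨⟨0, ⟨m.snd, congrArg TriMod.snd hm⟩⟩, TriMod.ext rfl rfl⟩
    · rintro ⟨x, rfl⟩
      exact TriMod.ext rfl (hex.apply_apply_eq_zero _)
  have hinj : Function.Injective (zModMap (LinearMap.ker p).subtype :
      zMod A B U (LinearMap.ker p) →ₗ[TriRing A B U] _) := fun m m' h =>
    TriMod.ext rfl (Subtype.ext (congrArg TriMod.snd h))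
  have hsurj : Function.Surjective (zModMap p : zMod A B U P →ₗ[TriRing A B U] _) :=
    fun m => by
      obtain ⟨y, hy⟩ := hp m.snd
      exact ⟨⟨0, y⟩, TriMod.ext rfl hy⟩
  constructor
  · intro h
    refine ext_one_of_exists_extension Subtype.val_injective hex hp fun g => ?_
    obtain ⟨k, hk⟩ := exists_extension_of_ext_one hinj hex' hsurj h (zModDesc g)
    refine ⟨zModRes k, LinearMap.ext fun x => Subtype.ext ?_⟩
    have h1 := LinearMap.congr_fun hk ⟨0, x⟩
    rw [zModDesc_apply] at h1
    exact h1
  · intro h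
    refine ext_one_of_exists_extension hinj hex' hsurj fun g => ?_
    obtain ⟨k, hk⟩ := exists_extension_of_ext_one Subtype.val_injective hex hp h (zModRes g)
    refine ⟨zModDesc k, zMod_hom_ext fun x => ?_⟩
    rw [LinearMap.comp_apply, zModDesc_apply]
    exact congrArg Subtype.val (LinearMap.congr_fun hk x)

/-- Dévissage along `0 → (H₁, U ⊗ H₁) → H → (0, Cok H) → 0`, whose left-hand injectivity is that of
`phi`. -/
theorem ext_one_of_fst_cok {H : Type u} [AddCommGroup H] [Module (TriRing A B U) H]
    (hφ : Function.Injective (phi A B U H))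
    (h₁ : Subsingleton (Ext (ModuleCat.of (TriRing A B U) (pFree A B U (Fst A B U H)))
      (ModuleCat.of (TriRing A B U) N) 1))
    (h₂ : Subsingleton (Ext (ModuleCat.of (TriRing A B U) (zMod A B U (Cok A B U H)))
      (ModuleCat.of (TriRing A B U) N) 1)) :
    Subsingleton (Ext (ModuleCat.of (TriRing A B U) H) (ModuleCat.of (TriRing A B U) N) 1) := by
  have hdesc : ∀ m : pFree A B U (Fst A B U H),
      pFreeDesc LinearMap.id m = (m.fst : H) + (phi A B U H m.snd : H) := fun m => by
    rw [pFreeDesc, TriMod.desc_apply, lTensor_id]; rfl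
  refine ext_one_of_exact (i := pFreeDesc (LinearMap.id : Fst A B U H →ₗ[A] _))
    (p := zModLift (LinearMap.id : Cok A B U H →ₗ[B] _)) ?_ ?_ ?_ h₁ h₂
  · intro m m' h
    rw [hdesc, hdesc] at h
    have e₁ := congrArg (projFst (A := A) (B := B) (U := U)) h
    have e₂ := congrArg (projSnd (A := A) (B := B) (U := U)) h
    simp only [map_add, projFst_coe, projFst_coe_snd, projSnd_coe, projSnd_coe_fst, add_zero,
      zero_add] at e₁ e₂
    exact TriMod.ext e₁ (hφ e₂)
  · intro x
    constructor
    · intro hx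
      obtain ⟨t, ht⟩ := (Submodule.Quotient.mk_eq_zero _).1 (congrArg TriMod.snd hx)
      refine ⟨⟨projFst x, t⟩, ?_⟩
      rw [hdesc, ht]
      exact projFst_add_projSnd A B U x
    · rintro ⟨m, rfl⟩
      rw [hdesc, zModLift_apply, map_add, projSnd_coe_fst, projSnd_coe, zero_add, mkQ_phi]
      rfl
  · intro m
    obtain ⟨y, hy⟩ := (LinearMap.range (phi A B U H)).mkQ_surjective m.snd
    refine ⟨y, TriMod.ext rfl ?_⟩
    rw [zModLift_apply, projSnd_coe]
    exact hy

/-- Forwards, test against `(X, U ⊗ X)` and `(0, Y)`; backwards, these two kinds of module build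
every `G_C`-projective by one extension. -/
theorem rightPerpOne_gProj_iff (hU : IsCompatible A B U C₁ C₂) :
    rightPerpOne (GProj (TriRing A B U) (pMod A B U C₁ C₂)) (ModuleCat.of (TriRing A B U) N) ↔
      rightPerpOne (GProj A C₁) (ModuleCat.of A (Fst A B U N)) ∧
        rightPerpOne (GProj B C₂) (ModuleCat.of B (Snd A B U N)) := by
  constructor
  · intro h
    exact ⟨fun X hX => (ext_one_pFree_iff hU hX).1 (h _ (gProj_pFree hU hX)),
      fun Y hY => ext_one_zMod_iff.1 (h _ (gProj_zMod hU hY))⟩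
  · rintro ⟨h₁, h₂⟩ H hH
    obtain ⟨hH₁, hφ, hH₂⟩ := gProj_fst_cok hU hH
    exact ext_one_of_fst_cok hφ ((ext_one_pFree_iff hU hH₁).2 (h₁ _ hH₁))
      (ext_one_zMod_iff.2 (h₂ _ hH₂))

end TriExt

/-! ### Kernels and surjectivity of morphisms of triples -/

section Kernel

variable {A B U : Type u} [Ring A] [Ring B] [AddCommGroup U] [Module B U] [Module Aᵐᵒᵖ U]
  [SMulCommClass B Aᵐᵒᵖ U]
variable {M₁ M₂ : Type u} [AddCommGroup M₁] [Module A M₁] [AddCommGroup M₂] [Module B M₂]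
variable {N₁ N₂ : Type u} [AddCommGroup N₁] [Module A N₁] [AddCommGroup N₂] [Module B N₂]
variable {φ : BTensor A B U M₁ →ₗ[B] M₂} {ψ : BTensor A B U N₁ →ₗ[B] N₂}
  (f₁ : M₁ →ₗ[A] N₁) (f₂ : M₂ →ₗ[B] N₂) (hf : f₂ ∘ₗ φ = ψ ∘ₗ lTensor A B U f₁)

theorem fst_ker_equiv : Nonempty (Fst A B U (LinearMap.ker (TriMod.map f₁ f₂ hf)) ≃ₗ[A]
    LinearMap.ker f₁) := by
  let q := (TriMod.fstEquiv φ).toLinearMap ∘ₗ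
    fstMap (LinearMap.ker (TriMod.map f₁ f₂ hf)).subtype
  refine ⟨LinearEquiv.ofBijective (q.codRestrict _ fun x => congrArg TriMod.fst x.1.2) ⟨?_, ?_⟩⟩
  · intro x y h
    exact fstMap_injective (f := (LinearMap.ker (TriMod.map f₁ f₂ hf)).subtype)
      Subtype.val_injective ((TriMod.fstEquiv φ).injective (congrArg Subtype.val h))
  · intro y
    exact ⟨⟨⟨⟨y, 0⟩, TriMod.ext y.2 (map_zero f₂)⟩, mem_fst.2 (Subtype.ext
      (mem_fst.1 (TriMod.mem_fst_iff.2 rfl)))⟩, rfl⟩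

theorem snd_ker_equiv : Nonempty (Snd A B U (LinearMap.ker (TriMod.map f₁ f₂ hf)) ≃ₗ[B]
    LinearMap.ker f₂) := by
  let q := (TriMod.sndEquiv φ).toLinearMap ∘ₗ
    sndMap (LinearMap.ker (TriMod.map f₁ f₂ hf)).subtype
  refine ⟨LinearEquiv.ofBijective (q.codRestrict _ fun x => congrArg TriMod.snd x.1.2) ⟨?_, ?_⟩⟩
  · intro x y h
    exact sndMap_injective (f := (LinearMap.ker (TriMod.map f₁ f₂ hf)).subtype)
      Subtype.val_injective ((TriMod.sndEquiv φ).injective (congrArg Subtype.val h))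
  · intro y
    exact ⟨⟨⟨⟨0, y⟩, TriMod.ext (map_zero f₁) y.2⟩, mem_snd.2 (Subtype.ext
      (mem_snd.1 (TriMod.mem_snd_iff.2 rfl)))⟩, rfl⟩

theorem rightPerpOne_ker_map_iff {C₁ C₂ : Type u} [AddCommGroup C₁] [Module A C₁]
    [AddCommGroup C₂] [Module B C₂] (hU : IsCompatible A B U C₁ C₂) :
    rightPerpOne (GProj (TriRing A B U) (pMod A B U C₁ C₂))
        (ModuleCat.of (TriRing A B U) (LinearMap.ker (TriMod.map f₁ f₂ hf))) ↔
      rightPerpOne (GProj A C₁) (ModuleCat.of A (LinearMap.ker f₁)) ∧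
        rightPerpOne (GProj B C₂) (ModuleCat.of B (LinearMap.ker f₂)) := by
  obtain ⟨e₁⟩ := fst_ker_equiv f₁ f₂ hf
  obtain ⟨e₂⟩ := snd_ker_equiv f₁ f₂ hf
  rw [rightPerpOne_gProj_iff hU]
  exact ⟨fun h => ⟨rightPerpOne_of_linearEquiv e₁ h.1, rightPerpOne_of_linearEquiv e₂ h.2⟩,
    fun h => ⟨rightPerpOne_of_linearEquiv e₁.symm h.1, rightPerpOne_of_linearEquiv e₂.symm h.2⟩⟩

theorem TriMod.map_surjective_iff : Function.Surjective (TriMod.map f₁ f₂ hf) ↔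
    Function.Surjective f₁ ∧ Function.Surjective f₂ := by
  constructor
  · refine fun h => ⟨fun x => ?_, fun y => ?_⟩
    · obtain ⟨m, hm⟩ := h ⟨x, 0⟩
      exact ⟨m.fst, congrArg TriMod.fst hm⟩
    · obtain ⟨m, hm⟩ := h ⟨0, y⟩
      exact ⟨m.snd, congrArg TriMod.snd hm⟩
  · rintro ⟨h₁, h₂⟩ m
    obtain ⟨x, hx⟩ := h₁ m.fst
    obtain ⟨y, hy⟩ := h₂ m.snd
    exact ⟨⟨x, y⟩, TriMod.ext hx hy⟩

end Kernel

end RelGor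

/-! ### Special precovers over the triangular matrix ring -/

theorem mainTheorem9 {A B U : Type u} [Ring A] [Ring B] [AddCommGroup U] [Module B U]
    [Module Aᵐᵒᵖ U] [SMulCommClass B Aᵐᵒᵖ U]
    {C₁ C₂ : Type u} [AddCommGroup C₁] [Module A C₁] [AddCommGroup C₂] [Module B C₂]
    (hC : RelGor.IsWTilting (RelGor.TriRing A B U) (RelGor.pMod A B U C₁ C₂))
    (hU : RelGor.IsCompatible A B U C₁ C₂)
    {M₁ M₂ G₁ G₂ : Type u} [AddCommGroup M₁] [Module A M₁] [AddCommGroup M₂] [Module B M₂]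
    [AddCommGroup G₁] [Module A G₁] [AddCommGroup G₂] [Module B G₂]
    (φM : RelGor.BTensor A B U M₁ →ₗ[B] M₂) (φG : RelGor.BTensor A B U G₁ →ₗ[B] G₂)
    (hG : RelGor.GProj (RelGor.TriRing A B U) (RelGor.pMod A B U C₁ C₂)
      (ModuleCat.of (RelGor.TriRing A B U) (RelGor.TriMod φG)))
    (f₁ : G₁ →ₗ[A] M₁) (f₂ : G₂ →ₗ[B] M₂)
    (hf : f₂ ∘ₗ φG = φM ∘ₗ RelGor.lTensor A B U f₁) :
    (RelGor.IsSpecialPrecover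
        (RelGor.GProj (RelGor.TriRing A B U) (RelGor.pMod A B U C₁ C₂))
        (RelGor.TriMod.map f₁ f₂ hf) ↔
      RelGor.IsSpecialPrecover (RelGor.GProj A C₁) f₁ ∧
        Function.Surjective f₂ ∧
        RelGor.rightPerpOne (RelGor.GProj B C₂) (ModuleCat.of B (LinearMap.ker f₂))) ∧
    (RelGor.IsSpecialPrecover
        (RelGor.GProj (RelGor.TriRing A B U) (RelGor.pMod A B U C₁ C₂))
        (RelGor.TriMod.map f₁ f₂ hf) →
      RelGor.GProj B C₂ (ModuleCat.of B G₂) →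
        RelGor.IsSpecialPrecover (RelGor.GProj B C₂) f₂) := by
  have key : RelGor.IsSpecialPrecover
        (RelGor.GProj (RelGor.TriRing A B U) (RelGor.pMod A B U C₁ C₂))
        (RelGor.TriMod.map f₁ f₂ hf) ↔
      RelGor.IsSpecialPrecover (RelGor.GProj A C₁) f₁ ∧
        Function.Surjective f₂ ∧
        RelGor.rightPerpOne (RelGor.GProj B C₂) (ModuleCat.of B (LinearMap.ker f₂)) := by
    -- Both membership conditions hold outright, so only surjectivity and the kernel conditions are
    -- left to match.
    have hG₁ : RelGor.GProj A C₁ (ModuleCat.of A G₁) :=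
      .of_equiv (RelGor.TriMod.fstEquiv φG) (RelGor.gProj_fst_cok hU hG).1
    rw [RelGor.isSpecialPrecover_iff, RelGor.isSpecialPrecover_iff,
      RelGor.rightPerpOne_ker_map_iff f₁ f₂ hf hU, RelGor.TriMod.map_surjective_iff]
    tauto
  exact ⟨key, fun h hG₂ => RelGor.isSpecialPrecover_iff.2 ⟨hG₂, (key.1 h).2⟩⟩
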